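/- Let $\mathscr D=\{[n2^k,(n+1)2^k): k,n\in\mathbb Z\}$ be the standard dyadic grid on $\mathbb R$. For $I\in\mathscr D$ let $I_-$ and $I_+$ be its left and right children, and let $I^s$ be its sibling, i.e. the other child of its dyadic parent. Let $\mu$ be a Borel measure on $\mathbb R$ with $0<\mu(I)<\infty$ for every $I\in\mathscr D$ and $\mu([0,\infty))=\mu((-\infty,0))=\infty$. Put $$m(I)=\frac{\mu(I_-)\mu(I_+)}{\mu(I)},\qquad h_I=\sqrt{m(I)}\left(\frac{\mathbf 1_{I_-}}{\mu(I_-)}-\frac{\mathbf 1_{I_+}}{\mu(I_+)}\right),\qquad \langle f,g\rangle=\int fg\,d\mu ,$$ and define the dyadic Hilbert transform on real-valued $f\in L^2(\mu)$ by $$\mathcal H f=\sum_{I\in\mathscr D}\bigl[\langle f,h_{I_+}\rangle h_{I_-}-\langle f,h_{I_-}\rangle h_{I_+}\bigr],$$ where the series converges unconditionally in $L^2(\mu)$. The measure $\mu$ is called sibling balanced if $\sup_{I\in\mathscr D} m(I)/m(I^s)<\infty$. We say that $\mathcal H$ is bounded on $L^p(\mu)$ if there is $C<\infty$ with $\|\mathcal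 H f\|_{L^p(\mu)}\le C\|f\|_{L^p(\mu)}$ for all $f\in L^2(\mu)\cap L^p(\mu)$ (equivalently, for $1<p<\infty$, $\mathcal H$ extends from $L^2(\mu)\cap L^p(\mu)$ to a bounded operator on $L^p(\mu)$), and that $\mathcal H$ is of weak type $(1,1)$ if there is $C<\infty$ with $t\,\mu(\{|\mathcal H f|>t\})\le C\|f\|_{L^1(\mu)}$ for all $t>0$ and all $f\in L^1(\mu)\cap L^2(\mu)$. Then the following are equivalent: 1. $\mathcal H$ is bounded on $L^p(\mu)$ for all $1<p<\infty$; 2. $\mathcal H$ is bounded on $L^p(\mu)$ for some $1<p<\infty$ with $p\ne2$; 3. $\mu$ is sibling balanced; 4. $\mathcal H$ is of weak type $(1,1)$. -/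

import Mathlib

open MeasureTheory Set
open scoped ENNReal NNReal

noncomputable section

/-- The index of a standard dyadic interval: `⟨k, n⟩` stands for `[n 2^k, (n+1) 2^k)`.
Different indices give different intervals. -/
@[ext] structure DyadicInterval where
  scale : ℤ
  pos : ℤ

namespace DyadicInterval

/-- The interval `[n 2^k, (n+1) 2^k)` itself. -/
def toSet (I : DyadicInterval) : Set ℝ :=
  Ico ((I.pos : ℝ) * (2 : ℝ) ^ I.scale) (((I.pos : ℝ) + 1) * (2 : ℝ) ^ I.scale)

/-- The left child `I₋`. -/
def left (I : DyadicInterval) : DyadicInterval := ⟨I.scale - 1, 2 * I.pos⟩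

/-- The right child `I₊`. -/
def right (I : DyadicInterval) : DyadicInterval := ⟨I.scale - 1, 2 * I.pos + 1⟩

/-- The dyadic parent. -/
def parent (I : DyadicInterval) : DyadicInterval := ⟨I.scale + 1, I.pos / 2⟩

/-- The sibling `Iˢ`: the other child of the parent of `I`. -/
def sibling (I : DyadicInterval) : DyadicInterval :=
  if Even I.pos then I.parent.right else I.parent.left

end DyadicInterval

/-- Standing assumptions on the Borel measure `μ` on `ℝ`: all dyadic intervals have positive and
finite measure, and both half-lines have infinite measure. -/
structure IsDyadicMeasure (μ : Measure ℝ) : Prop where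
  pos : ∀ I : DyadicInterval, 0 < μ I.toSet
  lt_top : ∀ I : DyadicInterval, μ I.toSet < ∞
  right_half : μ (Ici 0) = ∞
  left_half : μ (Iio 0) = ∞

/-- `m(I) = μ(I₋) μ(I₊) / μ(I)`. -/
def haarMass (μ : Measure ℝ) (I : DyadicInterval) : ℝ :=
  μ.real I.left.toSet * μ.real I.right.toSet / μ.real I.toSet

/-- The Haar function `h_I = √m(I) (1_{I₋} / μ(I₋) - 1_{I₊} / μ(I₊))`. -/
def haar (μ : Measure ℝ) (I : DyadicInterval) (x : ℝ) : ℝ :=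
  √(haarMass μ I) * (I.left.toSet.indicator 1 x / μ.real I.left.toSet -
    I.right.toSet.indicator 1 x / μ.real I.right.toSet)

/-- `μ` is sibling balanced: `sup_I m(I) / m(Iˢ) < ∞`. -/
def SiblingBalanced (μ : Measure ℝ) : Prop :=
  BddAbove (range fun I : DyadicInterval => haarMass μ I / haarMass μ I.sibling)

theorem memLp_haar {μ : Measure ℝ} (hμ : IsDyadicMeasure μ) (I : DyadicInterval) :
    MemLp (haar μ I) 2 μ := by
  have h : ∀ J : DyadicInterval, MemLp (J.toSet.indicator (1 : ℝ → ℝ)) 2 μ := fun J =>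
    memLp_indicator_const 2 measurableSet_Ico (1 : ℝ) (Or.inr (hμ.lt_top J).ne)
  have := (((h I.left).const_mul (μ.real I.left.toSet)⁻¹).sub
    ((h I.right).const_mul (μ.real I.right.toSet)⁻¹)).const_mul (√(haarMass μ I))
  refine this.ae_eq (Filter.Eventually.of_forall fun x => ?_)
  simp only [haar, Pi.sub_apply, div_eq_inv_mul]

/-- The Haar function as an element of `L²(μ)`. -/
def haarL2 {μ : Measure ℝ} (hμ : IsDyadicMeasure μ) (I : DyadicInterval) : Lp ℝ 2 μ :=
  (memLp_haar hμ I).toLp (haar μ I)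

/-- The term `⟨f, h_{I₊}⟩ h_{I₋} - ⟨f, h_{I₋}⟩ h_{I₊}` of the series for `𝓗 f`, where
`⟨f, g⟩ = ∫ f g dμ`. -/
def dyadicHilbertTerm {μ : Measure ℝ} (hμ : IsDyadicMeasure μ) (f : Lp ℝ 2 μ)
    (I : DyadicInterval) : Lp ℝ 2 μ :=
  (∫ x, f x * haar μ I.right x ∂μ) • haarL2 hμ I.left -
    (∫ x, f x * haar μ I.left x ∂μ) • haarL2 hμ I.right

/-- The dyadic Hilbert transform on `L²(μ)`,
`𝓗 f = ∑_I (⟨f, h_{I₊}⟩ h_{I₋} - ⟨f, h_{I₋}⟩ h_{I₊})`, the sum over all dyadic intervals being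
unconditionally convergent in `L²(μ)` (see `hasSum_dyadicHilbert`). -/
def dyadicHilbert {μ : Measure ℝ} (hμ : IsDyadicMeasure μ) (f : Lp ℝ 2 μ) : Lp ℝ 2 μ :=
  ∑' I : DyadicInterval, dyadicHilbertTerm hμ f I

/-- `𝓗` is (i.e. extends to) a bounded operator on `L^p(μ)`: the `L^p` bound holds on the dense
subspace `L²(μ) ∩ L^p(μ)`. -/
def HilbertBoundedOnLp {μ : Measure ℝ} (hμ : IsDyadicMeasure μ) (p : ℝ≥0∞) : Prop :=
  ∃ C : ℝ≥0, ∀ f : Lp ℝ 2 μ, MemLp f p μ →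
    eLpNorm (dyadicHilbert hμ f) p μ ≤ C * eLpNorm f p μ

/-- `𝓗` is of weak type `(1,1)`: `t μ{|𝓗 f| > t} ≤ C ‖f‖₁` for all `t > 0` and all `f` in the
dense subspace `L¹(μ) ∩ L²(μ)` of `L¹(μ)`. -/
def HilbertWeakType11 {μ : Measure ℝ} (hμ : IsDyadicMeasure μ) : Prop :=
  ∃ C : ℝ≥0, ∀ f : Lp ℝ 2 μ, MemLp f 1 μ → ∀ t : ℝ, 0 < t →
    ENNReal.ofReal t * μ {x | t < |dyadicHilbert hμ f x|} ≤ C * eLpNorm f 1 μ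

/-! The series defining `𝓗 f` converges in `L²(μ)`. -/

namespace DyadicInterval

theorem mem_toSet_iff (I : DyadicInterval) (x : ℝ) :
    x ∈ I.toSet ↔ ⌊x / (2 : ℝ) ^ I.scale⌋ = I.pos := by
  have h : (0 : ℝ) < 2 ^ I.scale := by positivity
  rw [toSet, mem_Ico, Int.floor_eq_iff, le_div_iff₀ h, div_lt_iff₀ h]

theorem floor_scale (x : ℝ) (k : ℤ) (j : ℕ) :
    ⌊x / (2 : ℝ) ^ (k + j)⌋ = ⌊x / (2 : ℝ) ^ k⌋ / 2 ^ j := by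
  have : x / (2 : ℝ) ^ (k + j) = x / (2 : ℝ) ^ k / ((2 ^ j : ℕ) : ℝ) := by
    rw [zpow_add₀ two_ne_zero, div_div]; simp
  rw [this, Int.floor_div_natCast]; simp

theorem subset_or_disjoint {I J : DyadicInterval} (h : I.scale ≤ J.scale) :
    I.toSet ⊆ J.toSet ∨ Disjoint I.toSet J.toSet := by
  obtain ⟨j, hj⟩ := Int.le.dest h
  by_cases hp : I.pos / 2 ^ j = J.pos
  · left
    intro x hx
    rw [mem_toSet_iff] at hx ⊢
    rw [← hj, floor_scale, hx, hp]
  · right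
    rw [Set.disjoint_left]
    intro x hx hx'
    rw [mem_toSet_iff] at hx hx'
    rw [← hj, floor_scale, hx] at hx'
    exact hp hx'

theorem disjoint_of_ne {I J : DyadicInterval} (h : I.scale = J.scale) (hne : I ≠ J) :
    Disjoint I.toSet J.toSet := by
  rw [Set.disjoint_left]
  intro x hx hx'
  rw [mem_toSet_iff] at hx hx'
  exact hne (DyadicInterval.ext h (by rw [← hx, ← hx', h]))

theorem left_union_right (I : DyadicInterval) : I.left.toSet ∪ I.right.toSet = I.toSet := by
  ext x
  have := floor_scale x (I.scale - 1) 1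
  simp only [Nat.cast_one, sub_add_cancel, pow_one] at this
  simp only [mem_union, mem_toSet_iff, left, right, this]
  omega

theorem disjoint_left_right (I : DyadicInterval) : Disjoint I.left.toSet I.right.toSet :=
  disjoint_of_ne rfl (by simp [left, right])

theorem measurableSet_toSet (I : DyadicInterval) : MeasurableSet I.toSet := measurableSet_Ico

end DyadicInterval

open DyadicInterval

theorem haar_eq_zero {μ : Measure ℝ} {I : DyadicInterval} {x : ℝ} (hx : x ∉ I.toSet) :
    haar μ I x = 0 := by
  rw [← left_union_right, mem_union, not_or] at hx
  simp [haar, hx.1, hx.2]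

theorem integral_haar {μ : Measure ℝ} (hμ : IsDyadicMeasure μ) (I : DyadicInterval) :
    ∫ x, haar μ I x ∂μ = 0 := by
  have hi : ∀ J : DyadicInterval, Integrable (J.toSet.indicator (1 : ℝ → ℝ)) μ := fun J =>
    (integrable_indicator_iff J.measurableSet_toSet).2
      (integrableOn_const (hμ.lt_top J).ne)
  have hp : ∀ J : DyadicInterval, μ.real J.toSet ≠ 0 := fun J =>
    (ENNReal.toReal_pos (hμ.pos J).ne' (hμ.lt_top J).ne).ne'
  unfold haar
  rw [integral_const_mul, integral_sub ((hi _).div_const _) ((hi _).div_const _),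
    integral_div, integral_div, integral_indicator_one (measurableSet_toSet _),
    integral_indicator_one (measurableSet_toSet _), div_self (hp _), div_self (hp _)]
  simp

theorem integral_haar_mul_self {μ : Measure ℝ} (hμ : IsDyadicMeasure μ) (I : DyadicInterval) :
    ∫ x, haar μ I x * haar μ I x ∂μ = 1 := by
  have hi : ∀ J : DyadicInterval, Integrable (J.toSet.indicator (1 : ℝ → ℝ)) μ := fun J =>
    (integrable_indicator_iff J.measurableSet_toSet).2
      (integrableOn_const (hμ.lt_top J).ne)
  have hp : ∀ J : DyadicInterval, 0 < μ.real J.toSet := fun J =>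
    ENNReal.toReal_pos (hμ.pos J).ne' (hμ.lt_top J).ne
  have ha := hp I.left
  have hb := hp I.right
  have hu : μ.real I.toSet = μ.real I.left.toSet + μ.real I.right.toSet := by
    rw [← left_union_right]
    exact measureReal_union I.disjoint_left_right (measurableSet_toSet _)
      (hμ.lt_top _).ne (hμ.lt_top _).ne
  have hm : 0 ≤ haarMass μ I := by unfold haarMass; positivity
  have key : ∀ x, haar μ I x * haar μ I x =
      haarMass μ I * (I.left.toSet.indicator 1 x / (μ.real I.left.toSet) ^ 2 +
        I.right.toSet.indicator 1 x / (μ.real I.right.toSet) ^ 2) := by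
    intro x
    have hs : √(haarMass μ I) * √(haarMass μ I) = haarMass μ I := Real.mul_self_sqrt hm
    have hd : x ∈ I.left.toSet → x ∉ I.right.toSet :=
      fun h => Set.disjoint_left.1 I.disjoint_left_right h
    unfold haar
    rw [mul_mul_mul_comm, hs]
    by_cases h1 : x ∈ I.left.toSet
    · simp [h1, hd h1, pow_two]
    · by_cases h2 : x ∈ I.right.toSet
      · simp [h1, h2, pow_two]
      · simp [h1, h2]
  simp_rw [key]
  rw [integral_const_mul, integral_add ((hi _).div_const _) ((hi _).div_const _),
    integral_div, integral_div, integral_indicator_one (measurableSet_toSet _),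
    integral_indicator_one (measurableSet_toSet _), haarMass, hu]
  field_simp
  exact add_comm _ _

theorem integral_haar_mul_haar {μ : Measure ℝ} (hμ : IsDyadicMeasure μ) {I J : DyadicInterval}
    (h : I.scale ≤ J.scale) (hne : I ≠ J) : ∫ x, haar μ I x * haar μ J x ∂μ = 0 := by
  rcases h.eq_or_lt with h | h
  · have hd := Set.disjoint_left.1 (disjoint_of_ne h hne)
    have : ∀ x, haar μ I x * haar μ J x = 0 := fun x => by
      by_cases hx : x ∈ I.toSet
      · rw [haar_eq_zero (hd hx), mul_zero]
      · rw [haar_eq_zero hx, zero_mul]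
    simp [this]
  · have hc : ∃ c : ℝ, ∀ x ∈ I.toSet, haar μ J x = c := by
      have hind : ∀ K : DyadicInterval, I.scale ≤ K.scale → ∃ c : ℝ, ∀ x ∈ I.toSet,
          K.toSet.indicator (1 : ℝ → ℝ) x = c := by
        intro K hK
        rcases subset_or_disjoint hK with hs | hd
        · exact ⟨1, fun x hx => by simp [hs hx]⟩
        · exact ⟨0, fun x hx => by simp [Set.disjoint_left.1 hd hx]⟩
      obtain ⟨a, ha⟩ := hind J.left (by simp only [left]; omega)
      obtain ⟨b, hb⟩ := hind J.right (by simp only [right]; omega)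
      exact ⟨_, fun x hx => by unfold haar; rw [ha x hx, hb x hx]⟩
    obtain ⟨c, hc⟩ := hc
    have : ∀ x, haar μ I x * haar μ J x = haar μ I x * c := fun x => by
      by_cases hx : x ∈ I.toSet
      · rw [hc x hx]
      · rw [haar_eq_zero hx, zero_mul, zero_mul]
    simp_rw [this]
    rw [integral_mul_const, integral_haar hμ, zero_mul]

theorem inner_haarL2 {μ : Measure ℝ} (hμ : IsDyadicMeasure μ) (I : DyadicInterval)
    (f : Lp ℝ 2 μ) : inner ℝ (haarL2 hμ I) f = ∫ x, f x * haar μ I x ∂μ := by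
  rw [L2.inner_def]
  refine integral_congr_ae ?_
  filter_upwards [(memLp_haar hμ I).coeFn_toLp] with x hx
  simp [haarL2, hx]

theorem orthonormal_haarL2 {μ : Measure ℝ} (hμ : IsDyadicMeasure μ) :
    Orthonormal ℝ (haarL2 hμ) := by
  classical
  rw [orthonormal_iff_ite]
  intro I J
  have e : inner ℝ (haarL2 hμ I) (haarL2 hμ J) = ∫ x, haar μ I x * haar μ J x ∂μ := by
    rw [inner_haarL2]
    refine integral_congr_ae ?_
    filter_upwards [(memLp_haar hμ J).coeFn_toLp] with x hx
    rw [haarL2, hx, mul_comm]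
  rw [e]
  split_ifs with h
  · rw [← h, integral_haar_mul_self hμ]
  · rcases le_total I.scale J.scale with hs | hs
    · exact integral_haar_mul_haar hμ hs h
    · simp_rw [mul_comm (haar μ I _)]
      exact integral_haar_mul_haar hμ hs (Ne.symm h)

theorem hasSum_dyadicHilbert {μ : Measure ℝ} (hμ : IsDyadicMeasure μ) (f : Lp ℝ 2 μ) :
    HasSum (dyadicHilbertTerm hμ f) (dyadicHilbert hμ f) := by
  have hl : Function.Injective DyadicInterval.left := fun I J h => by
    simp only [left, DyadicInterval.mk.injEq] at h
    exact DyadicInterval.ext (by omega) (by omega)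
  have hr : Function.Injective DyadicInterval.right := fun I J h => by
    simp only [right, DyadicInterval.mk.injEq] at h
    exact DyadicInterval.ext (by omega) (by omega)
  have key : ∀ u v : DyadicInterval → DyadicInterval, Function.Injective u →
      Function.Injective v →
      Summable fun I => (∫ x, f x * haar μ (u I) x ∂μ) • haarL2 hμ (v I) := by
    intro u v hu hv
    have h1 := (orthonormal_haarL2 hμ).comp v hv
    have h2 := ((orthonormal_haarL2 hμ).comp u hu).inner_products_summable f
    have h3 := (h1.orthogonalFamily.summable_iff_norm_sq_summable
      (fun I => ∫ x, f x * haar μ (u I) x ∂μ)).2 (by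
        simpa only [← inner_haarL2 hμ, Function.comp_apply] using h2)
    simpa using h3
  exact ((key _ _ hr hl).sub (key _ _ hl hr)).hasSum

end

/-! Regrouped by children, the operator is a signed shuffle of Haar functions: `𝓗 f = ∑_J ε_J ⟨f,
h_J⟩ h_{Jˢ}` with `ε_J = ±1`. Hence it is a contraction of `L²` for every `μ`, it is antisymmetric,
and it sends `h_J` to `± h_{Jˢ}`. Moreover `m(J)` is comparable to the measure of the smaller child
of `J`, so `‖h_J‖_p^p` is comparable to `m(J)^(1 - p/2)` for `1 < p < ∞`, and `‖h_J‖₁ = 2 √m(J)`.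

Necessity of balance: testing on `h_J` compares powers of `m(Jˢ)` and `m(J)`. The exponent `1 - p/2`
vanishes only for `p = 2`, so any other `p` gives balance; the weak type bound does so on a level
set of `h_{Jˢ}`.

Sufficiency: the core is the weak type bound (`weakType_of_haarMass_sibling_le`). Stop at the
maximal dyadic intervals over which `|f|` has average above `t`; their union has measure at most
`‖f‖₁ / t`. Split the series according to whether `J` is good, meaning that `J`, its ancestors and
its children all have averages of `|f|` at most `t`. The good part is estimated in `L²`. A convex
function equal to `u²` on `[-t, t]` and growing linearly beyond has an energy that increases under
refinement, is at most `2t ‖f‖₁` at every scale, and gains exactly `⟨f, h_J⟩²` at a good `J`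
(`tsum_huberGain_le`). This takes the place of a Calderón–Zygmund decomposition. The bad part is
estimated in `L¹` off the stopping set. If a strict ancestor of `J` is big, `h_{Jˢ}` lives inside
the stopping set. Otherwise `J` or a child of it is a stopping interval `Q`, and `√m(J) |⟨f, h_J⟩| ≤
2 ∫_Q |f|`; balance converts `‖h_{Jˢ}‖₁ = 2 √m(Jˢ)` into a multiple of `√m(J)`.

Interpolation with the `L²` contraction covers `1 < p < 2`, and antisymmetry transfers these bounds
to `p > 2`. -/

/-! ### Ancestors, siblings and children of dyadic intervals -/

namespace DyadicInterval

/-- The dyadic interval of length `2 ^ n |J|` containing `J`. -/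
def ancestor (J : DyadicInterval) (n : ℕ) : DyadicInterval := ⟨J.scale + n, J.pos / 2 ^ n⟩

theorem ancestor_zero (J : DyadicInterval) : J.ancestor 0 = J := by
  simp [ancestor]

theorem parent_ancestor (J : DyadicInterval) (n : ℕ) :
    J.parent.ancestor n = J.ancestor (n + 1) := by
  ext
  · simp only [ancestor, parent]; push_cast; ring
  · simp only [ancestor, parent]
    rw [Int.ediv_ediv_of_nonneg (by norm_num), pow_succ']

theorem ancestor_one (J : DyadicInterval) : J.ancestor 1 = J.parent := by
  rw [← parent_ancestor, ancestor_zero]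

theorem left_parent (J : DyadicInterval) : J.left.parent = J := by
  ext <;> simp [left, parent]

theorem right_parent (J : DyadicInterval) : J.right.parent = J := by
  ext
  · simp [right, parent]
  · simp only [right, parent]; omega

theorem ancestor_ancestor (J : DyadicInterval) (m n : ℕ) :
    (J.ancestor m).ancestor n = J.ancestor (m + n) := by
  ext
  · simp only [ancestor]; push_cast; ring
  · simp only [ancestor]
    rw [Int.ediv_ediv_of_nonneg (by positivity), pow_add]

theorem mem_ancestor {J : DyadicInterval} {x : ℝ} (hx : x ∈ J.toSet) (n : ℕ) :
    x ∈ (J.ancestor n).toSet := by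
  rw [mem_toSet_iff] at hx ⊢
  simp only [ancestor]
  rw [floor_scale, hx]

theorem toSet_subset_ancestor (J : DyadicInterval) (n : ℕ) :
    J.toSet ⊆ (J.ancestor n).toSet := fun _ hx => mem_ancestor hx n

theorem eq_ancestor_of_mem {J J' : DyadicInterval} {x : ℝ} {n : ℕ} (hx : x ∈ J.toSet)
    (hx' : x ∈ J'.toSet) (h : J.scale + n = J'.scale) : J' = J.ancestor n := by
  rw [mem_toSet_iff] at hx hx'
  ext
  · exact h.symm
  · simp only [ancestor]
    rw [← hx', ← h, floor_scale, hx]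

theorem sibling_left (J : DyadicInterval) : J.left.sibling = J.right := by
  rw [sibling, left_parent, if_pos (by simp [left])]

theorem sibling_right (J : DyadicInterval) : J.right.sibling = J.left := by
  rw [sibling, right_parent, if_neg (by simp [right])]

theorem eq_left_or_right (J : DyadicInterval) : J = J.parent.left ∨ J = J.parent.right := by
  rcases Int.even_or_odd' J.pos with ⟨k, hk | hk⟩
  · left; ext <;> simp [left, parent]; omega
  · right; ext <;> simp [right, parent]; omega

theorem sibling_sibling (J : DyadicInterval) : J.sibling.sibling = J := by
  rcases eq_left_or_right J with h | h <;> rw [h]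
  · rw [sibling_left, sibling_right]
  · rw [sibling_right, sibling_left]

theorem sibling_injective : Function.Injective sibling :=
  Function.LeftInverse.injective sibling_sibling

theorem sibling_parent (J : DyadicInterval) : J.sibling.parent = J.parent := by
  rcases eq_left_or_right J with h | h <;> rw [h]
  · rw [sibling_left, right_parent, left_parent]
  · rw [sibling_right, right_parent, left_parent]

theorem sibling_subset_parent (J : DyadicInterval) : J.sibling.toSet ⊆ J.parent.toSet := by
  rw [← sibling_parent, ← ancestor_one]
  exact toSet_subset_ancestor _ _

/-- A dyadic interval is encoded by its scale and its position. -/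
def equivProd : ℤ × ℤ ≃ DyadicInterval where
  toFun p := ⟨p.1, p.2⟩
  invFun I := (I.scale, I.pos)

instance : Countable DyadicInterval := equivProd.symm.countable_iff.2 inferInstance

/-- A dyadic interval is encoded by its parent and a side. -/
def childEquiv : DyadicInterval × Bool ≃ DyadicInterval where
  toFun p := if p.2 then p.1.right else p.1.left
  invFun I := (I.parent, decide (Odd I.pos))
  left_inv := by
    rintro ⟨I, b⟩
    cases b
    · simp [left_parent]; simp [left]
    · simp [right_parent]; simp [right]
  right_inv := by
    intro I
    rcases Int.even_or_odd I.pos with h | h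
    · simp only [Int.not_odd_iff_even.2 h, decide_false]
      rcases eq_left_or_right I with h' | h'
      · exact h'.symm
      · rw [h'] at h; exact absurd h (by simp [right])
    · simp only [h, decide_true]
      rcases eq_left_or_right I with h' | h'
      · rw [h'] at h; exact absurd h (by simp [left])
      · exact h'.symm

/-- Serves twice: to pass from one scale to the next in the energy argument, and to count stopping
intervals through their parents. -/
theorem tsum_childEquiv (F : DyadicInterval → ℝ≥0∞) :
    ∑' J, F J = ∑' I : DyadicInterval, (F I.left + F I.right) := by
  rw [← childEquiv.tsum_eq F, ENNReal.tsum_prod']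
  refine tsum_congr fun I => ?_
  rw [tsum_bool]
  simp [childEquiv]

end DyadicInterval

/-! ### Growth of ancestors and the size of `m(I)` -/

section

open DyadicInterval

/-- The ancestors of `J` exhaust the half-line that contains `J`, and this half-line has infinite
measure. This is what makes maximal big intervals exist. -/
theorem exists_lt_measure_ancestor {μ : Measure ℝ} (hμ : IsDyadicMeasure μ) (J : DyadicInterval)
    {a : ℝ≥0∞} (ha : a < ∞) : ∃ N : ℕ, ∀ n, N ≤ n → a < μ (J.ancestor n).toSet := by
  have hmono : Monotone fun n => (J.ancestor n).toSet := fun m n hmn => by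
    obtain ⟨k, rfl⟩ := Nat.exists_eq_add_of_le hmn
    simp only [← ancestor_ancestor]
    exact toSet_subset_ancestor _ _
  have hU : μ (⋃ n, (J.ancestor n).toSet) = ∞ := by
    have hlim : ∀ b : ℝ, ∃ n : ℕ, b / 2 ^ J.scale < 2 ^ n := fun b =>
      pow_unbounded_of_one_lt _ one_lt_two
    have hs : (0 : ℝ) < 2 ^ J.scale := by positivity
    have hpos : ∃ k : ℕ, |J.pos| < 2 ^ k := by
      obtain ⟨k, hk⟩ := pow_unbounded_of_one_lt |J.pos| (one_lt_two (α := ℤ))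
      exact ⟨k, hk⟩
    obtain ⟨k, hk⟩ := hpos
    have hp2 : ∀ n, k ≤ n → |J.pos| < 2 ^ n := fun n hn =>
      hk.trans_le (pow_le_pow_right₀ one_le_two hn)
    rcases le_or_gt 0 J.pos with h0 | h0
    · refine top_unique ?_
      rw [← hμ.right_half]
      refine measure_mono fun x hx => ?_
      obtain ⟨n, hn⟩ := hlim x
      refine mem_iUnion.2 ⟨max n k, ?_⟩
      have h1 : J.pos / 2 ^ (max n k) = 0 :=
        Int.ediv_eq_zero_of_lt h0 ((le_abs_self _).trans_lt (hp2 _ (le_max_right _ _)))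
      have h2 : x < 2 ^ (max n k) * 2 ^ J.scale := by
        rw [← div_lt_iff₀ hs]
        exact hn.trans_le (pow_le_pow_right₀ one_le_two (le_max_left _ _))
      simp only [ancestor, toSet, h1, mem_Ico, Int.cast_zero, zero_mul, zero_add, one_mul]
      refine ⟨hx, h2.trans_eq ?_⟩
      rw [zpow_add₀ two_ne_zero, zpow_natCast, mul_comm]
    · refine top_unique ?_
      rw [← hμ.left_half]
      refine measure_mono fun x hx => ?_
      obtain ⟨n, hn⟩ := hlim (-x)
      refine mem_iUnion.2 ⟨max n k, ?_⟩
      -- Integer division rounds down, so negative positions stabilise at `-1`, the dyadic intervals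
      -- ending at the origin.
      have h1 : J.pos / 2 ^ (max n k) = -1 := by
        have := hp2 _ (le_max_right n k)
        rw [abs_lt] at this
        have hp : (0 : ℤ) < 2 ^ (max n k) := by positivity
        refine le_antisymm ?_ ?_
        · exact Int.le_of_lt_add_one (by simpa using (Int.ediv_lt_iff_lt_mul hp).2 (by simpa))
        · rw [Int.le_ediv_iff_mul_le hp]; linarith
      have h2 : -x < 2 ^ (max n k) * 2 ^ J.scale := by
        rw [← div_lt_iff₀ hs]
        exact hn.trans_le (pow_le_pow_right₀ one_le_two (le_max_left _ _))
      have h3 : (2 : ℝ) ^ (J.scale + (max n k : ℕ)) = 2 ^ (max n k) * 2 ^ J.scale := by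
        rw [zpow_add₀ two_ne_zero, zpow_natCast, mul_comm]
      simp only [ancestor, toSet, h1, mem_Ico, h3]
      push_cast
      refine ⟨by linarith, ?_⟩
      have : x < 0 := hx
      linarith
  have ht := tendsto_measure_iUnion_atTop (μ := μ) hmono
  rw [hU] at ht
  exact Filter.eventually_atTop.1 (ht.eventually (lt_mem_nhds ha))

namespace IsDyadicMeasure

variable {μ : Measure ℝ} (hμ : IsDyadicMeasure μ)
include hμ

theorem real_pos (I : DyadicInterval) : 0 < μ.real I.toSet :=
  ENNReal.toReal_pos (hμ.pos I).ne' (hμ.lt_top I).ne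

theorem ofReal_real (I : DyadicInterval) : ENNReal.ofReal (μ.real I.toSet) = μ I.toSet :=
  ENNReal.ofReal_toReal (hμ.lt_top I).ne

theorem real_eq_add (I : DyadicInterval) :
    μ.real I.toSet = μ.real I.left.toSet + μ.real I.right.toSet := by
  rw [← left_union_right]
  exact measureReal_union I.disjoint_left_right (measurableSet_toSet _)
    (hμ.lt_top _).ne (hμ.lt_top _).ne

theorem haarMass_pos (I : DyadicInterval) : 0 < haarMass μ I := by
  have h1 := hμ.real_pos I
  have h2 := hμ.real_pos I.left
  have h3 := hμ.real_pos I.right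
  unfold haarMass
  positivity

/-- With `a`, `b` the measures of the children, `m(I) = ab / (a + b)` lies between half the minimum
of `a`, `b` and the minimum itself. This lemma and the next two record both bounds. -/
theorem haarMass_le_left (I : DyadicInterval) : haarMass μ I ≤ μ.real I.left.toSet := by
  have h2 := hμ.real_pos I.left
  have h3 := hμ.real_pos I.right
  rw [haarMass, div_le_iff₀ (hμ.real_pos I), hμ.real_eq_add I]
  nlinarith

theorem haarMass_le_right (I : DyadicInterval) : haarMass μ I ≤ μ.real I.right.toSet := by
  have h2 := hμ.real_pos I.left
  have h3 := hμ.real_pos I.right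
  rw [haarMass, div_le_iff₀ (hμ.real_pos I), hμ.real_eq_add I]
  nlinarith

theorem left_le_or_right_le (I : DyadicInterval) :
    μ.real I.left.toSet ≤ 2 * haarMass μ I ∨ μ.real I.right.toSet ≤ 2 * haarMass μ I := by
  have h2 := hμ.real_pos I.left
  have h3 := hμ.real_pos I.right
  have h1 := hμ.real_pos I
  rcases le_total (μ.real I.left.toSet) (μ.real I.right.toSet) with h | h
  · left
    rw [haarMass, mul_div_assoc', le_div_iff₀ h1, hμ.real_eq_add I]
    nlinarith
  · right
    rw [haarMass, mul_div_assoc', le_div_iff₀ h1, hμ.real_eq_add I]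
    nlinarith

end IsDyadicMeasure

/-! ### Values and norms of Haar functions -/

theorem haar_of_mem_left {μ : Measure ℝ} {I : DyadicInterval} {x : ℝ} (hx : x ∈ I.left.toSet) :
    haar μ I x = √(haarMass μ I) / μ.real I.left.toSet := by
  have : x ∉ I.right.toSet := Set.disjoint_left.1 I.disjoint_left_right hx
  simp [haar, hx, this, div_eq_mul_inv]

theorem haar_of_mem_right {μ : Measure ℝ} {I : DyadicInterval} {x : ℝ}
    (hx : x ∈ I.right.toSet) : haar μ I x = -(√(haarMass μ I) / μ.real I.right.toSet) := by
  have : x ∉ I.left.toSet := Set.disjoint_right.1 I.disjoint_left_right hx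
  simp [haar, hx, this, div_eq_mul_inv]

theorem measurable_haar (μ : Measure ℝ) (I : DyadicInterval) : Measurable (haar μ I) := by
  have h : ∀ J : DyadicInterval, Measurable (J.toSet.indicator (1 : ℝ → ℝ)) := fun J =>
    measurable_one.indicator J.measurableSet_toSet
  exact (((h _).div_const _).sub ((h _).div_const _)).const_mul _

theorem enorm_haar (μ : Measure ℝ) (I : DyadicInterval) (x : ℝ) : ‖haar μ I x‖ₑ =
    I.left.toSet.indicator (fun _ => ENNReal.ofReal (√(haarMass μ I) / μ.real I.left.toSet)) x +
    I.right.toSet.indicator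
      (fun _ => ENNReal.ofReal (√(haarMass μ I) / μ.real I.right.toSet)) x := by
  by_cases h1 : x ∈ I.left.toSet
  · have h2 : x ∉ I.right.toSet := Set.disjoint_left.1 I.disjoint_left_right h1
    rw [haar_of_mem_left h1, Real.enorm_of_nonneg (by positivity)]
    simp [h1, h2]
  · by_cases h2 : x ∈ I.right.toSet
    · rw [haar_of_mem_right h2, enorm_neg, Real.enorm_of_nonneg (by positivity)]
      simp [h1, h2]
    · rw [haar_eq_zero (by rw [← left_union_right]; simp [h1, h2])]
      simp [h1, h2]

/-- The `p`-th power of the absolute value of a Haar function has an explicit integral. -/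
theorem lintegral_enorm_haar_rpow {μ : Measure ℝ} (hμ : IsDyadicMeasure μ) (I : DyadicInterval)
    {p : ℝ} (hp : 0 < p) : ∫⁻ x, ‖haar μ I x‖ₑ ^ p ∂μ = ENNReal.ofReal
      (haarMass μ I ^ (p / 2) *
        (μ.real I.left.toSet ^ (1 - p) + μ.real I.right.toSet ^ (1 - p))) := by
  have hm := hμ.haarMass_pos I
  have key : ∀ J : DyadicInterval,
      ENNReal.ofReal (√(haarMass μ I) / μ.real J.toSet) ^ p * μ J.toSet =
        ENNReal.ofReal (haarMass μ I ^ (p / 2) * μ.real J.toSet ^ (1 - p)) := by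
    intro J
    have hJ := hμ.real_pos J
    rw [← hμ.ofReal_real J, ENNReal.ofReal_rpow_of_nonneg (by positivity) hp.le,
      ← ENNReal.ofReal_mul (by positivity), Real.div_rpow (by positivity) hJ.le,
      Real.sqrt_eq_rpow, ← Real.rpow_mul hm.le, Real.rpow_sub hJ, Real.rpow_one]
    congr 1
    rw [show (1 : ℝ) / 2 * p = p / 2 by ring]
    field_simp
  have hpt : ∀ x, ‖haar μ I x‖ₑ ^ p =
      I.left.toSet.indicator
        (fun _ => ENNReal.ofReal (√(haarMass μ I) / μ.real I.left.toSet) ^ p) x +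
      I.right.toSet.indicator
        (fun _ => ENNReal.ofReal (√(haarMass μ I) / μ.real I.right.toSet) ^ p) x := by
    intro x
    rw [enorm_haar]
    by_cases h1 : x ∈ I.left.toSet
    · have h2 : x ∉ I.right.toSet := Set.disjoint_left.1 I.disjoint_left_right h1
      simp [h1, h2]
    · by_cases h2 : x ∈ I.right.toSet <;> simp [h1, h2, hp]
  simp_rw [hpt]
  rw [lintegral_add_left (measurable_const.indicator I.left.measurableSet_toSet),
    lintegral_indicator_const I.left.measurableSet_toSet,
    lintegral_indicator_const I.right.measurableSet_toSet, key, key,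
    ← ENNReal.ofReal_add (by positivity) (by positivity), mul_add]

theorem lintegral_enorm_haar {μ : Measure ℝ} (hμ : IsDyadicMeasure μ) (I : DyadicInterval) :
    ∫⁻ x, ‖haar μ I x‖ₑ ∂μ = ENNReal.ofReal (2 * √(haarMass μ I)) := by
  have := lintegral_enorm_haar_rpow hμ I one_pos
  simp only [ENNReal.rpow_one, sub_self, Real.rpow_zero] at this
  rw [this, Real.sqrt_eq_rpow]
  congr 1
  ring

/-! Averages and Haar coefficients. -/

/-- The average of `f` over a dyadic interval. -/
noncomputable def dyadicAverage (μ : Measure ℝ) (f : ℝ → ℝ) (I : DyadicInterval) : ℝ :=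
  (∫ x in I.toSet, f x ∂μ) / μ.real I.toSet

/-- The Haar coefficient `⟨f, h_I⟩`. -/
noncomputable def haarCoeff (μ : Measure ℝ) (f : ℝ → ℝ) (I : DyadicInterval) : ℝ :=
  ∫ x, f x * haar μ I x ∂μ

section Averages

variable {μ : Measure ℝ} (hμ : IsDyadicMeasure μ) {f : ℝ → ℝ}
include hμ

theorem real_mul_dyadicAverage (I : DyadicInterval) :
    μ.real I.toSet * dyadicAverage μ f I = ∫ x in I.toSet, f x ∂μ := by
  have := hμ.real_pos I
  unfold dyadicAverage
  field_simp

theorem dyadicAverage_split (hf : Integrable f μ) (I : DyadicInterval) :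
    μ.real I.toSet * dyadicAverage μ f I =
      μ.real I.left.toSet * dyadicAverage μ f I.left +
        μ.real I.right.toSet * dyadicAverage μ f I.right := by
  simp only [real_mul_dyadicAverage hμ]
  rw [← left_union_right I]
  exact setIntegral_union I.disjoint_left_right (measurableSet_toSet _) hf.integrableOn
    hf.integrableOn

omit hμ in
theorem haarCoeff_eq (hf : Integrable f μ) (I : DyadicInterval) :
    haarCoeff μ f I =
      √(haarMass μ I) * (dyadicAverage μ f I.left - dyadicAverage μ f I.right) := by
  have : ∀ x, f x * haar μ I x = √(haarMass μ I) *
      (I.left.toSet.indicator f x / μ.real I.left.toSet -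
        I.right.toSet.indicator f x / μ.real I.right.toSet) := by
    intro x
    simp only [haar, indicator, Pi.one_apply]
    split_ifs <;> ring
  unfold haarCoeff
  simp_rw [this]
  rw [integral_const_mul, integral_sub ((hf.indicator (measurableSet_toSet _)).div_const _)
    ((hf.indicator (measurableSet_toSet _)).div_const _), integral_div, integral_div,
    integral_indicator (measurableSet_toSet _), integral_indicator (measurableSet_toSet _)]
  rfl

/-- Comparing a child with its parent eliminates the other child. At a stopping child the parent
average is at most `t`, whereas the average over the sibling need not be. -/
theorem sqrt_haarMass_mul_haarCoeff_left (hf : Integrable f μ) (I : DyadicInterval) :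
    √(haarMass μ I) * haarCoeff μ f I =
      μ.real I.left.toSet * (dyadicAverage μ f I.left - dyadicAverage μ f I) := by
  have h1 := dyadicAverage_split hμ hf I
  have h0 := hμ.real_pos I
  have h2 := hμ.real_eq_add I
  rw [haarCoeff_eq hf, ← mul_assoc, Real.mul_self_sqrt (hμ.haarMass_pos I).le, haarMass,
    div_mul_eq_mul_div, div_eq_iff h0.ne', mul_assoc, mul_assoc, sub_mul _ (dyadicAverage μ f I),
    mul_comm (dyadicAverage μ f I) (μ.real I.toSet), h1, h2]
  ring

theorem sqrt_haarMass_mul_haarCoeff_right (hf : Integrable f μ) (I : DyadicInterval) :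
    √(haarMass μ I) * haarCoeff μ f I =
      μ.real I.right.toSet * (dyadicAverage μ f I - dyadicAverage μ f I.right) := by
  have h1 := dyadicAverage_split hμ hf I
  rw [sqrt_haarMass_mul_haarCoeff_left hμ hf, mul_sub, mul_sub]
  have h2 := hμ.real_eq_add I
  rw [h2, add_mul] at h1
  linarith

/-- The squared coefficient is the variance between the two children, that is, the gain of quadratic
energy. -/
theorem haarCoeff_sq (hf : Integrable f μ) (I : DyadicInterval) :
    haarCoeff μ f I ^ 2 = μ.real I.left.toSet * dyadicAverage μ f I.left ^ 2 +
      μ.real I.right.toSet * dyadicAverage μ f I.right ^ 2 -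
        μ.real I.toSet * dyadicAverage μ f I ^ 2 := by
  have h1 := dyadicAverage_split hμ hf I
  have h0 := hμ.real_pos I
  have h2 := hμ.real_eq_add I
  have h3 : dyadicAverage μ f I = (μ.real I.left.toSet * dyadicAverage μ f I.left +
      μ.real I.right.toSet * dyadicAverage μ f I.right) / μ.real I.toSet := by
    rw [← h1]; field_simp
  rw [haarCoeff_eq hf, mul_pow, Real.sq_sqrt (hμ.haarMass_pos I).le, haarMass, h3, h2]
  rw [h2] at h0
  field_simp
  ring

theorem abs_real_mul_dyadicAverage_le (I : DyadicInterval) :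
    μ.real I.toSet * |dyadicAverage μ f I| ≤ ∫ x in I.toSet, |f x| ∂μ := by
  rw [← abs_of_pos (hμ.real_pos I), ← abs_mul, real_mul_dyadicAverage hμ]
  exact abs_integral_le_integral_abs

end Averages

/-! The series in terms of siblings. -/

/-- The sign with which `⟨f, h_J⟩ h_{Jˢ}` enters the dyadic Hilbert transform. -/
noncomputable def siblingSign (J : DyadicInterval) : ℝ := if Even J.pos then -1 else 1

theorem siblingSign_left (J : DyadicInterval) : siblingSign J.left = -1 := by
  simp [siblingSign, left]

theorem siblingSign_right (J : DyadicInterval) : siblingSign J.right = 1 := by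
  simp [siblingSign, right]

theorem abs_siblingSign (J : DyadicInterval) : |siblingSign J| = 1 := by
  unfold siblingSign
  split_ifs <;> simp

section Series

variable {μ : Measure ℝ} (hμ : IsDyadicMeasure μ)

theorem orthonormal_haarL2_sibling : Orthonormal ℝ fun J => haarL2 hμ (sibling J) :=
  (orthonormal_haarL2 hμ).comp _ sibling_injective

include hμ in
theorem summable_sq_haarCoeff (f : Lp ℝ 2 μ) : Summable fun J => haarCoeff μ f J ^ 2 := by
  have := (orthonormal_haarL2 hμ).inner_products_summable f
  simpa [inner_haarL2, haarCoeff] using this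

include hμ in
theorem tsum_sq_haarCoeff_le (f : Lp ℝ 2 μ) : ∑' J, haarCoeff μ f J ^ 2 ≤ ‖f‖ ^ 2 := by
  have := (orthonormal_haarL2 hμ).tsum_inner_products_le f
  simpa [inner_haarL2, haarCoeff] using this

theorem summable_smul_haarL2_sibling {c : DyadicInterval → ℝ} (hc : Summable fun J => c J ^ 2) :
    Summable fun J => c J • haarL2 hμ J.sibling := by
  have h := ((orthonormal_haarL2_sibling hμ).orthogonalFamily.summable_iff_norm_sq_summable c).2
    (by simpa using hc)
  simpa using h

theorem norm_sq_of_hasSum {c : DyadicInterval → ℝ} {v : Lp ℝ 2 μ}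
    (hv : HasSum (fun J => c J • haarL2 hμ J.sibling) v) :
    HasSum (fun J => c J ^ 2) (‖v‖ ^ 2) := by
  have h := (Filter.Tendsto.norm hv).pow 2
  refine h.congr fun s => ?_
  have := (orthonormal_haarL2_sibling hμ).orthogonalFamily.norm_sum c s
  simpa using this

/-- Every interval is a child of exactly one parent, and the series over children converges
unconditionally, so its two-term groups may be summed first. -/
theorem hasSum_dyadicHilbert_sibling (f : Lp ℝ 2 μ) :
    HasSum (fun J => (siblingSign J * haarCoeff μ f J) • haarL2 hμ J.sibling)
      (dyadicHilbert hμ f) := by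
  have hs : Summable fun J => (siblingSign J * haarCoeff μ f J) ^ 2 := by
    refine (summable_sq_haarCoeff hμ f).congr fun J => ?_
    rw [mul_pow, ← sq_abs (siblingSign J), abs_siblingSign, one_pow, one_mul]
  have h1 := (summable_smul_haarL2_sibling hμ hs).hasSum
  have h2 := (childEquiv.hasSum_iff.2 h1).prod_fiberwise fun I => hasSum_fintype _
  have h3 : ∀ I, ∑ b : Bool, ((fun J => (siblingSign J * haarCoeff μ f J) •
      haarL2 hμ J.sibling) ∘ childEquiv) (I, b) = dyadicHilbertTerm hμ f I := by
    intro I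
    simp only [Fintype.sum_bool, Function.comp_apply, childEquiv, Equiv.coe_fn_mk, if_true,
      Bool.false_eq_true, if_false, siblingSign_left, siblingSign_right, sibling_left,
      sibling_right, one_mul, neg_mul, neg_smul, dyadicHilbertTerm, haarCoeff, sub_eq_add_neg]
  simp only [h3] at h2
  rw [(hasSum_dyadicHilbert hμ f).unique h2]
  exact h1

end Series

/-- The `L¹` norm over a set of the sum of an `L²`-convergent series is at most the sum of the
`L¹` norms of the terms. -/
theorem lintegral_enorm_hasSum_le {α ι : Type*} [MeasurableSpace α] [Countable ι]
    {μ : Measure α} {F : ι → Lp ℝ 2 μ} {u : Lp ℝ 2 μ} (hu : HasSum F u) (E : Set α) :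
    ∫⁻ x in E, ‖u x‖ₑ ∂μ ≤ ∑' i, ∫⁻ x in E, ‖F i x‖ₑ ∂μ := by
  -- Convergence in `L²` implies convergence in measure, hence almost everywhere along a sequence of
  -- finite partial sums; Fatou's lemma then applies.
  obtain ⟨ns, -, hns⟩ := (tendstoInMeasure_of_tendsto_Lp hu).exists_seq_tendsto_ae'
  have h1 : ∫⁻ x in E, ‖u x‖ₑ ∂μ ≤
      Filter.liminf (fun n => ∫⁻ x in E, ‖(∑ i ∈ ns n, F i : Lp ℝ 2 μ) x‖ₑ ∂μ)
        Filter.atTop := by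
    refine le_trans (le_of_eq (lintegral_congr_ae ?_)) (lintegral_liminf_le' fun n =>
      (Lp.aestronglyMeasurable _).aemeasurable.enorm.restrict)
    filter_upwards [ae_restrict_of_ae hns] with x hx
    exact hx.enorm.liminf_eq.symm
  refine h1.trans (Filter.liminf_le_of_le (by isBoundedDefault) fun b hb => ?_)
  obtain ⟨n, hn⟩ := hb.exists
  refine hn.trans ?_
  calc ∫⁻ x in E, ‖(∑ i ∈ ns n, F i : Lp ℝ 2 μ) x‖ₑ ∂μ
      ≤ ∫⁻ x in E, ∑ i ∈ ns n, ‖F i x‖ₑ ∂μ := by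
        refine lintegral_mono_ae (ae_restrict_of_ae ?_)
        filter_upwards [Lp.coeFn_finsetSum (ns n) F] with x hx
        rw [hx, Finset.sum_apply]
        exact enorm_sum_le (ns n) fun i => F i x
    _ = ∑ i ∈ ns n, ∫⁻ x in E, ‖F i x‖ₑ ∂μ :=
        lintegral_finsetSum' _ fun i _ =>
          (Lp.aestronglyMeasurable _).aemeasurable.enorm.restrict
    _ ≤ _ := ENNReal.sum_le_tsum _

/-! A convex function that is quadratic up to height `t` and grows linearly from there on. -/

/-- The Huber function: quadratic on `[-t, t]`, continued linearly in a convex way. -/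
noncomputable def huber (t u : ℝ) : ℝ := if |u| ≤ t then u ^ 2 else 2 * t * |u| - t ^ 2

theorem huber_of_abs_le {t u : ℝ} (h : |u| ≤ t) : huber t u = u ^ 2 := if_pos h

/-- Together with `exists_huber_eq` this presents the function as the maximum over `|s| ≤ t` of the
affine functions `u ↦ 2su - s²`, which is the form of convexity used for Jensen's inequality. -/
theorem le_huber {t s : ℝ} (hs : |s| ≤ t) (u : ℝ) : 2 * s * u - s ^ 2 ≤ huber t u := by
  unfold huber
  split_ifs with h
  · nlinarith [sq_nonneg (u - s)]
  · have h1 : s * u ≤ |s| * |u| := by rw [← abs_mul]; exact le_abs_self _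
    have h2 := sq_abs s
    push Not at h
    nlinarith [mul_nonneg (sub_nonneg.2 hs) (by linarith : 0 ≤ 2 * |u| - t - |s|)]

theorem exists_huber_eq {t : ℝ} (ht : 0 ≤ t) (u : ℝ) :
    ∃ s, |s| ≤ t ∧ huber t u = 2 * s * u - s ^ 2 := by
  by_cases h : |u| ≤ t
  · exact ⟨u, h, by rw [huber_of_abs_le h]; ring⟩
  · rcases abs_cases u with ⟨h1, -⟩ | ⟨h1, -⟩
    · exact ⟨t, (abs_of_nonneg ht).le, by rw [huber, if_neg h, h1]⟩
    · exact ⟨-t, by rw [abs_neg, abs_of_nonneg ht], by rw [huber, if_neg h, h1]; ring⟩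

theorem huber_nonneg {t : ℝ} (ht : 0 ≤ t) (u : ℝ) : 0 ≤ huber t u := by
  simpa using le_huber (t := t) (s := 0) (by simpa) u

theorem huber_le {t : ℝ} (ht : 0 ≤ t) (u : ℝ) : huber t u ≤ 2 * t * |u| := by
  unfold huber
  split_ifs with h
  · rw [← sq_abs]; nlinarith [abs_nonneg u]
  · nlinarith [sq_nonneg t]

/-- The integrals of a function over disjoint dyadic intervals add up to at most its integral. -/
theorem tsum_indicator_setLIntegral_le {μ : Measure ℝ} (F : ℝ → ℝ≥0∞) {S : Set DyadicInterval}
    (hS : S.PairwiseDisjoint toSet) :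
    ∑' J, S.indicator (fun J => ∫⁻ x in J.toSet, F x ∂μ) J ≤ ∫⁻ x, F x ∂μ := by
  rw [← tsum_subtype S (fun J => ∫⁻ x in J.toSet, F x ∂μ),
    ← lintegral_biUnion S.to_countable (fun J _ => J.measurableSet_toSet) hS]
  exact setLIntegral_le_lintegral _ _

theorem pairwiseDisjoint_scale (k : ℤ) : {J : DyadicInterval | J.scale = k}.PairwiseDisjoint
    toSet := fun _ hI _ hJ hne => disjoint_of_ne (hI.trans hJ.symm) hne

section Huber

variable {μ : Measure ℝ} {f : ℝ → ℝ} {t : ℝ}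

theorem ofReal_setIntegral_abs (hf : Integrable f μ) (I : DyadicInterval) :
    ENNReal.ofReal (∫ x in I.toSet, |f x| ∂μ) = ∫⁻ x in I.toSet, ‖f x‖ₑ ∂μ :=
  ofReal_integral_norm_eq_lintegral_enorm hf.integrableOn

/-- The Huber energy of `f` over a dyadic interval. -/
noncomputable def huberEnergy (μ : Measure ℝ) (f : ℝ → ℝ) (t : ℝ) (I : DyadicInterval) : ℝ :=
  μ.real I.toSet * huber t (dyadicAverage μ f I)

/-- The gain of Huber energy on passing from a dyadic interval to its children. -/
noncomputable def huberGain (μ : Measure ℝ) (f : ℝ → ℝ) (t : ℝ) (I : DyadicInterval) : ℝ :=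
  huberEnergy μ f t I.left + huberEnergy μ f t I.right - huberEnergy μ f t I

theorem huberEnergy_nonneg (ht : 0 ≤ t) (I : DyadicInterval) : 0 ≤ huberEnergy μ f t I :=
  mul_nonneg measureReal_nonneg (huber_nonneg ht _)

/-- Jensen's inequality for two points, by means of the supporting line at the average over `I`. -/
theorem huberGain_nonneg (hμ : IsDyadicMeasure μ) (hf : Integrable f μ) (ht : 0 ≤ t)
    (I : DyadicInterval) : 0 ≤ huberGain μ f t I := by
  obtain ⟨s, hs, he⟩ := exists_huber_eq ht (dyadicAverage μ f I)
  have h1 := dyadicAverage_split hμ hf I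
  have h2 := hμ.real_eq_add I
  have h3 := mul_le_mul_of_nonneg_left (le_huber hs (dyadicAverage μ f I.left))
    (hμ.real_pos I.left).le
  have h4 := mul_le_mul_of_nonneg_left (le_huber hs (dyadicAverage μ f I.right))
    (hμ.real_pos I.right).le
  have h5 : μ.real I.toSet * huber t (dyadicAverage μ f I) =
      2 * s * (μ.real I.left.toSet * dyadicAverage μ f I.left +
        μ.real I.right.toSet * dyadicAverage μ f I.right) -
      s ^ 2 * (μ.real I.left.toSet + μ.real I.right.toSet) := by
    rw [he, ← h1, ← h2]; ring
  unfold huberGain huberEnergy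
  linarith

/-- The total Huber energy at a given scale. -/
noncomputable def huberScale (μ : Measure ℝ) (f : ℝ → ℝ) (t : ℝ) (k : ℤ) : ℝ≥0∞ :=
  ∑' J, {J : DyadicInterval | J.scale = k}.indicator
    (fun J => ENNReal.ofReal (huberEnergy μ f t J)) J

theorem huberScale_le (hμ : IsDyadicMeasure μ) (hf : Integrable f μ) (ht : 0 ≤ t) (k : ℤ) :
    huberScale μ f t k ≤ ENNReal.ofReal (2 * t) * ∫⁻ x, ‖f x‖ₑ ∂μ := by
  refine le_trans ?_ (mul_le_mul_right (tsum_indicator_setLIntegral_le (μ := μ)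
    (fun x => ‖f x‖ₑ) (pairwiseDisjoint_scale k)) _)
  rw [← ENNReal.tsum_mul_left]
  refine ENNReal.tsum_le_tsum fun J => ?_
  by_cases hJ : J ∈ {J : DyadicInterval | J.scale = k}
  · rw [indicator_of_mem hJ, indicator_of_mem hJ, ← ofReal_setIntegral_abs hf,
      ← ENNReal.ofReal_mul (by positivity)]
    refine ENNReal.ofReal_le_ofReal ?_
    have h1 := abs_real_mul_dyadicAverage_le hμ (f := f) J
    have h2 := mul_le_mul_of_nonneg_left (huber_le ht (dyadicAverage μ f J)) (hμ.real_pos J).le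
    have h3 := mul_le_mul_of_nonneg_left h1 (by positivity : 0 ≤ 2 * t)
    unfold huberEnergy
    linarith
  · rw [indicator_of_notMem hJ]
    exact zero_le

theorem huberScale_add_gain (hμ : IsDyadicMeasure μ) (hf : Integrable f μ) (ht : 0 ≤ t) (k : ℤ) :
    huberScale μ f t k = huberScale μ f t (k + 1) +
      ∑' J, {J : DyadicInterval | J.scale = k + 1}.indicator
        (fun J => ENNReal.ofReal (huberGain μ f t J)) J := by
  unfold huberScale
  rw [tsum_childEquiv, ← ENNReal.tsum_add]
  refine tsum_congr fun J => ?_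
  by_cases hJ : J.scale = k + 1
  · have h1 : J.left.scale = k := by simp [left, hJ]
    have h2 : J.right.scale = k := by simp [right, hJ]
    simp only [indicator, mem_ofPred_eq, hJ, h1, h2, if_true]
    rw [← ENNReal.ofReal_add (huberEnergy_nonneg ht _) (huberEnergy_nonneg ht _),
      ← ENNReal.ofReal_add (huberEnergy_nonneg ht _) (huberGain_nonneg hμ hf ht _)]
    congr 1
    unfold huberGain
    ring
  · have h1 : J.left.scale ≠ k := by simp only [left]; omega
    have h2 : J.right.scale ≠ k := by simp only [right]; omega
    simp [indicator, hJ, h1, h2]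

/-- The gains telescope over scales: those in a finite window add up to at most the energy at the
finest scale, which is bounded uniformly in the scale. -/
theorem tsum_huberGain_le (hμ : IsDyadicMeasure μ) (hf : Integrable f μ) (ht : 0 ≤ t) :
    ∑' J, ENNReal.ofReal (huberGain μ f t J) ≤ ENNReal.ofReal (2 * t) * ∫⁻ x, ‖f x‖ₑ ∂μ := by
  have key : ∀ (k : ℤ) (N : ℕ), huberScale μ f t k = huberScale μ f t (k + N) +
      ∑' J, {J : DyadicInterval | k < J.scale ∧ J.scale ≤ k + N}.indicator
        (fun J => ENNReal.ofReal (huberGain μ f t J)) J := by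
    intro k N
    induction N with
    | zero =>
      have : {J : DyadicInterval | k < J.scale ∧ J.scale ≤ k + (0 : ℕ)} = ∅ := by
        ext J; simp
      rw [this]; simp
    | succ N ih =>
      rw [ih, huberScale_add_gain hμ hf ht (k + N), add_assoc, ← ENNReal.tsum_add]
      have e : k + (N : ℤ) + 1 = k + (N + 1 : ℕ) := by push_cast; ring
      rw [e]
      congr 1
      refine tsum_congr fun J => ?_
      simp only [indicator, mem_ofPred_eq]
      push_cast
      split_ifs <;> first | omega | simp
  rw [ENNReal.tsum_eq_iSup_sum]
  refine iSup_le fun F => ?_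
  obtain ⟨b, hb⟩ : ∃ b : ℕ, ∀ J ∈ F, J.scale.natAbs ≤ b :=
    ⟨F.sup fun J => J.scale.natAbs, fun J hJ =>
      Finset.le_sup (f := fun J : DyadicInterval => J.scale.natAbs) hJ⟩
  -- The window `(-b - 1, b]` of scales contains the finite set `F`; its length is `2b + 1`.
  refine le_trans ?_ (huberScale_le hμ hf ht (-(b : ℤ) - 1))
  rw [key _ (2 * b + 1)]
  refine le_trans ?_ le_add_self
  refine le_trans (Finset.sum_le_sum fun J hJ => ?_) (ENNReal.sum_le_tsum F)
  have := hb J hJ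
  rw [indicator_of_mem]
  simp only [mem_ofPred_eq]
  push_cast
  omega

end Huber

/-! The stopping intervals. -/

section Stopping

variable {μ : Measure ℝ} {f : ℝ → ℝ} {t : ℝ}

/-- The dyadic intervals over which the average of `|f|` exceeds `t`. -/
def bigIntervals (μ : Measure ℝ) (f : ℝ → ℝ) (t : ℝ) : Set DyadicInterval :=
  {J | t * μ.real J.toSet < ∫ x in J.toSet, |f x| ∂μ}

/-- The maximal dyadic intervals over which the average of `|f|` exceeds `t`. -/
def stoppingIntervals (μ : Measure ℝ) (f : ℝ → ℝ) (t : ℝ) : Set DyadicInterval :=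
  {J | J ∈ bigIntervals μ f t ∧ ∀ n, J.ancestor (n + 1) ∉ bigIntervals μ f t}

/-- The union of the stopping intervals. -/
def stoppingSet (μ : Measure ℝ) (f : ℝ → ℝ) (t : ℝ) : Set ℝ :=
  ⋃ J ∈ stoppingIntervals μ f t, J.toSet

/-- The dyadic intervals that are not contained in the stopping set, and have no child that is. -/
def goodIntervals (μ : Measure ℝ) (f : ℝ → ℝ) (t : ℝ) : Set DyadicInterval :=
  {J | (∀ n, J.ancestor n ∉ bigIntervals μ f t) ∧ J.left ∉ bigIntervals μ f t ∧
    J.right ∉ bigIntervals μ f t}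

theorem measurableSet_stoppingSet : MeasurableSet (stoppingSet μ f t) :=
  MeasurableSet.biUnion (to_countable _) fun J _ => J.measurableSet_toSet

theorem pairwiseDisjoint_stoppingIntervals : (stoppingIntervals μ f t).PairwiseDisjoint toSet := by
  have key : ∀ I ∈ stoppingIntervals μ f t, ∀ J ∈ stoppingIntervals μ f t, I.scale ≤ J.scale →
      I ≠ J → Disjoint I.toSet J.toSet := by
    intro I hI J hJ h hne
    rw [Set.disjoint_left]
    intro x hx hx'
    obtain ⟨n, hn⟩ := Int.le.dest h
    have := eq_ancestor_of_mem hx hx' hn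
    cases n with
    | zero => exact hne (by rw [this, ancestor_zero])
    | succ n => exact hI.2 n (this ▸ hJ.1)
  intro I hI J hJ hne
  rcases le_total I.scale J.scale with h | h
  · exact key I hI J hJ h hne
  · exact (key J hJ I hI h hne.symm).symm

theorem exists_ancestor_mem_stoppingIntervals (hμ : IsDyadicMeasure μ) (hf : Integrable f μ)
    (ht : 0 < t) {J : DyadicInterval} (hJ : J ∈ bigIntervals μ f t) :
    ∃ n, J.ancestor n ∈ stoppingIntervals μ f t := by
  classical
  obtain ⟨N, hN⟩ := exists_lt_measure_ancestor hμ J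
    (ENNReal.ofReal_lt_top (r := (∫ x, |f x| ∂μ) / t))
  -- A big interval has measure less than `‖f‖₁ / t`, so only finitely many ancestors are big and
  -- the last of them is maximal.
  have hbound : ∀ n, J.ancestor n ∈ bigIntervals μ f t → n ≤ N := by
    intro n hn
    by_contra! hlt
    have h1 := hN n hlt.le
    have h2 : t * μ.real (J.ancestor n).toSet < _ := hn
    have h3 : ∫ x in (J.ancestor n).toSet, |f x| ∂μ ≤ ∫ x, |f x| ∂μ :=
      setIntegral_le_integral hf.abs (ae_of_all _ fun _ => abs_nonneg _)
    rw [← hμ.ofReal_real, ENNReal.ofReal_lt_ofReal_iff (hμ.real_pos _), div_lt_iff₀ ht] at h1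
    linarith
  have h0 : J.ancestor 0 ∈ bigIntervals μ f t := by rwa [ancestor_zero]
  refine ⟨Nat.findGreatest (fun n => J.ancestor n ∈ bigIntervals μ f t) N, ?_, fun n hn => ?_⟩
  · exact Nat.findGreatest_spec (P := fun n => J.ancestor n ∈ bigIntervals μ f t) (zero_le) h0
  · rw [ancestor_ancestor] at hn
    have := Nat.le_findGreatest (P := fun n => J.ancestor n ∈ bigIntervals μ f t) (hbound _ hn) hn
    omega

theorem toSet_subset_stoppingSet (hμ : IsDyadicMeasure μ) (hf : Integrable f μ)
    (ht : 0 < t) {J : DyadicInterval} {n : ℕ} (hJ : J.ancestor n ∈ bigIntervals μ f t) :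
    J.toSet ⊆ stoppingSet μ f t := by
  obtain ⟨k, hk⟩ := exists_ancestor_mem_stoppingIntervals hμ hf ht hJ
  exact ((J.toSet_subset_ancestor n).trans (toSet_subset_ancestor _ k)).trans
    (subset_biUnion_of_mem (u := fun J : DyadicInterval => J.toSet) hk)

theorem measure_stoppingSet_le (hμ : IsDyadicMeasure μ) (hf : Integrable f μ) (ht : 0 < t) :
    ENNReal.ofReal t * μ (stoppingSet μ f t) ≤ ∫⁻ x, ‖f x‖ₑ ∂μ := by
  refine le_trans ?_ (tsum_indicator_setLIntegral_le (μ := μ) (fun x => ‖f x‖ₑ)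
    (pairwiseDisjoint_stoppingIntervals (μ := μ) (f := f) (t := t)))
  rw [← tsum_subtype (stoppingIntervals μ f t) (fun J => ∫⁻ x in J.toSet, ‖f x‖ₑ ∂μ)]
  refine (mul_le_mul_right (measure_biUnion_le μ (to_countable _) _) _).trans ?_
  rw [← ENNReal.tsum_mul_left]
  refine ENNReal.tsum_le_tsum fun J => ?_
  rw [← hμ.ofReal_real, ← ENNReal.ofReal_mul ht.le, ← ofReal_setIntegral_abs hf]
  exact ENNReal.ofReal_le_ofReal (le_of_lt J.2.1)

theorem abs_dyadicAverage_le (hμ : IsDyadicMeasure μ) {J : DyadicInterval}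
    (hJ : J ∉ bigIntervals μ f t) : |dyadicAverage μ f J| ≤ t := by
  have h1 := abs_real_mul_dyadicAverage_le hμ (f := f) J
  have h2 : ∫ x in J.toSet, |f x| ∂μ ≤ t * μ.real J.toSet := not_lt.1 hJ
  have h3 := hμ.real_pos J
  nlinarith

/-- The Haar coefficients at the good intervals are square summable with the expected bound. -/
theorem tsum_sq_haarCoeff_goodIntervals_le (hμ : IsDyadicMeasure μ) (hf : Integrable f μ)
    (ht : 0 < t) :
    ∑' J, (goodIntervals μ f t).indicator (fun J => ENNReal.ofReal (haarCoeff μ f J ^ 2)) J ≤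
      ENNReal.ofReal (2 * t) * ∫⁻ x, ‖f x‖ₑ ∂μ := by
  refine le_trans (ENNReal.tsum_le_tsum fun J => ?_) (tsum_huberGain_le hμ hf ht.le)
  refine indicator_apply_le' (fun hJ => ?_) fun _ => zero_le
  have h0 := abs_dyadicAverage_le hμ (hJ.1 0)
  rw [ancestor_zero] at h0
  -- All three averages lie in `[-t, t]`, where the Huber function is the square, so the gain equals
  -- the squared coefficient.
  rw [haarCoeff_sq hμ hf, huberGain, huberEnergy, huberEnergy, huberEnergy,
    huber_of_abs_le h0, huber_of_abs_le (abs_dyadicAverage_le hμ hJ.2.1),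
    huber_of_abs_le (abs_dyadicAverage_le hμ hJ.2.2)]

theorem sqrt_haarMass_mul_abs_haarCoeff_le (hμ : IsDyadicMeasure μ) (hf : Integrable f μ)
    (I : DyadicInterval) : √(haarMass μ I) * |haarCoeff μ f I| ≤ ∫ x in I.toSet, |f x| ∂μ := by
  have hm := (hμ.haarMass_pos I).le
  have h1 := abs_real_mul_dyadicAverage_le hμ (f := f) I.left
  have h2 := abs_real_mul_dyadicAverage_le hμ (f := f) I.right
  have h3 : ∫ x in I.toSet, |f x| ∂μ =
      ∫ x in I.left.toSet, |f x| ∂μ + ∫ x in I.right.toSet, |f x| ∂μ := by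
    rw [← left_union_right I]
    exact setIntegral_union I.disjoint_left_right (measurableSet_toSet _) hf.abs.integrableOn
      hf.abs.integrableOn
  rw [haarCoeff_eq hf, abs_mul, abs_of_nonneg (Real.sqrt_nonneg _), ← mul_assoc,
    Real.mul_self_sqrt hm, h3]
  have h4 := abs_sub (dyadicAverage μ f I.left) (dyadicAverage μ f I.right)
  have h5 := mul_le_mul_of_nonneg_left h4 hm
  have h6 := mul_le_mul_of_nonneg_right (hμ.haarMass_le_left I)
    (abs_nonneg (dyadicAverage μ f I.left))
  have h7 := mul_le_mul_of_nonneg_right (hμ.haarMass_le_right I)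
    (abs_nonneg (dyadicAverage μ f I.right))
  linarith

/-- Since `I` is not big its average is at most `t`, and `t μ(Q) < ∫_Q |f|` because `Q` is big; each
of the two averages thus costs one integral. -/
theorem mul_abs_sub_dyadicAverage_le (hμ : IsDyadicMeasure μ)
    {I Q : DyadicInterval} (hI : I ∉ bigIntervals μ f t) (hQ : Q ∈ bigIntervals μ f t) :
    μ.real Q.toSet * |dyadicAverage μ f Q - dyadicAverage μ f I| ≤
      2 * ∫ x in Q.toSet, |f x| ∂μ := by
  have h1 := abs_real_mul_dyadicAverage_le hμ (f := f) Q
  have h2 := abs_dyadicAverage_le hμ hI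
  have h3 : t * μ.real Q.toSet < ∫ x in Q.toSet, |f x| ∂μ := hQ
  have h4 := mul_le_mul_of_nonneg_left
    (abs_sub (dyadicAverage μ f Q) (dyadicAverage μ f I)) (hμ.real_pos Q).le
  have h5 := mul_le_mul_of_nonneg_left h2 (hμ.real_pos Q).le
  linarith

/-- Outside the stopping set the Haar coefficients at the bad intervals are controlled by the
integrals of `|f|` over the stopping intervals. -/
theorem sqrt_haarMass_mul_abs_haarCoeff_le_of_bad (hμ : IsDyadicMeasure μ) (hf : Integrable f μ)
    {J : DyadicInterval} (hJ : J ∉ goodIntervals μ f t)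
    (hp : ∀ n, J.ancestor (n + 1) ∉ bigIntervals μ f t) :
    ENNReal.ofReal (√(haarMass μ J) * |haarCoeff μ f J|) ≤ 2 *
      ((stoppingIntervals μ f t).indicator (fun Q => ∫⁻ x in Q.toSet, ‖f x‖ₑ ∂μ) J +
      ((stoppingIntervals μ f t).indicator (fun Q => ∫⁻ x in Q.toSet, ‖f x‖ₑ ∂μ) J.left +
      (stoppingIntervals μ f t).indicator (fun Q => ∫⁻ x in Q.toSet, ‖f x‖ₑ ∂μ) J.right)) := by
  have htwo : ∀ r : ℝ, ENNReal.ofReal (2 * r) = 2 * ENNReal.ofReal r := fun r => by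
    rw [ENNReal.ofReal_mul zero_le_two]; simp
  by_cases hB : J ∈ bigIntervals μ f t
  · have hM : J ∈ stoppingIntervals μ f t := ⟨hB, hp⟩
    rw [indicator_of_mem hM]
    refine le_trans ?_ (mul_le_mul_right le_self_add _)
    rw [← ofReal_setIntegral_abs hf, ← htwo]
    refine ENNReal.ofReal_le_ofReal ((sqrt_haarMass_mul_abs_haarCoeff_le hμ hf J).trans ?_)
    have : 0 ≤ ∫ x in J.toSet, |f x| ∂μ := integral_nonneg fun _ => abs_nonneg _
    linarith
  · have hall : ∀ n, J.ancestor n ∉ bigIntervals μ f t := by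
      rintro (_ | n)
      · rwa [ancestor_zero]
      · exact hp n
    have hs : √(haarMass μ J) * |haarCoeff μ f J| = |√(haarMass μ J) * haarCoeff μ f J| := by
      rw [abs_mul, abs_of_nonneg (Real.sqrt_nonneg _)]
    by_cases hl : J.left ∈ bigIntervals μ f t
    · have hM : J.left ∈ stoppingIntervals μ f t :=
        ⟨hl, fun n => by rw [← parent_ancestor, left_parent]; exact hall n⟩
      rw [indicator_of_mem hM]
      refine le_trans ?_ (mul_le_mul_right (le_self_add.trans le_add_self) _)
      rw [← ofReal_setIntegral_abs hf, ← htwo, hs, sqrt_haarMass_mul_haarCoeff_left hμ hf, abs_mul,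
        abs_of_pos (hμ.real_pos _)]
      exact ENNReal.ofReal_le_ofReal (mul_abs_sub_dyadicAverage_le hμ hB hl)
    · have hr : J.right ∈ bigIntervals μ f t := by
        by_contra hr
        exact hJ ⟨hall, hl, hr⟩
      have hM : J.right ∈ stoppingIntervals μ f t :=
        ⟨hr, fun n => by rw [← parent_ancestor, right_parent]; exact hall n⟩
      rw [indicator_of_mem hM]
      refine le_trans ?_ (mul_le_mul_right (le_add_self.trans le_add_self) _)
      rw [← ofReal_setIntegral_abs hf, ← htwo, hs, sqrt_haarMass_mul_haarCoeff_right hμ hf,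
        abs_mul, abs_of_pos (hμ.real_pos _), abs_sub_comm]
      exact ENNReal.ofReal_le_ofReal (mul_abs_sub_dyadicAverage_le hμ hB hr)

end Stopping

/-! ### Chebyshev inequalities for `L²` functions -/

section LTwo

variable {μ : Measure ℝ}

theorem lintegral_enorm_sq_Lp_two (u : Lp ℝ 2 μ) :
    ∫⁻ x, ‖u x‖ₑ ^ (2 : ℝ) ∂μ = ENNReal.ofReal (‖u‖ ^ 2) := by
  have h := eLpNorm_eq_lintegral_rpow_enorm_toReal (f := u) (μ := μ) two_ne_zero
    ENNReal.ofNat_ne_top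
  rw [ENNReal.toReal_ofNat] at h
  rw [ENNReal.ofReal_pow (norm_nonneg _), ofReal_norm, Lp.enorm_def, h, ← ENNReal.rpow_natCast,
    ← ENNReal.rpow_mul]
  norm_num

theorem meas_lt_abs_le_of_norm_sq (u : Lp ℝ 2 μ) {s : ℝ} (hs : 0 < s) :
    ENNReal.ofReal (s ^ 2) * μ {x | s < |u x|} ≤ ENNReal.ofReal (‖u‖ ^ 2) := by
  rw [← lintegral_enorm_sq_Lp_two]
  refine le_trans ?_ (mul_meas_ge_le_lintegral₀
    ((Lp.aestronglyMeasurable u).aemeasurable.enorm.pow_const _) (ENNReal.ofReal (s ^ 2)))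
  refine mul_le_mul_right (measure_mono fun x hx => ?_) _
  have hx : s < |u x| := hx
  simp only [mem_ofPred_eq]
  rw [← ofReal_norm, Real.norm_eq_abs, ENNReal.ofReal_rpow_of_nonneg (abs_nonneg _) zero_le_two]
  refine ENNReal.ofReal_le_ofReal ?_
  rw [Real.rpow_two]
  gcongr

theorem meas_lt_abs_inter_le (u : Lp ℝ 2 μ) {s : ℝ} (E : Set ℝ) (hE : MeasurableSet E) :
    ENNReal.ofReal s * μ ({x | s < |u x|} ∩ E) ≤ ∫⁻ x in E, ‖u x‖ₑ ∂μ := by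
  refine le_trans ?_ (mul_meas_ge_le_lintegral₀
    (Lp.aestronglyMeasurable u).aemeasurable.enorm.restrict (ENNReal.ofReal s))
  refine mul_le_mul_right ?_ _
  rw [← Measure.restrict_apply' hE]
  refine measure_mono fun x hx => ?_
  have hx : s < |u x| := hx
  simp only [mem_ofPred_eq]
  rw [← ofReal_norm, Real.norm_eq_abs]
  exact ENNReal.ofReal_le_ofReal hx.le

end LTwo

/-! ### The weak type bound for sibling balanced measures -/

section WeakType

variable {μ : Measure ℝ} (hμ : IsDyadicMeasure μ) (f : Lp ℝ 2 μ) {t : ℝ}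

/-- The part of the dyadic Hilbert transform that comes from the intervals in `S`. -/
noncomputable def partialHilbert (S : Set DyadicInterval) : Lp ℝ 2 μ :=
  ∑' J, S.indicator (fun J => siblingSign J * haarCoeff μ f J) J • haarL2 hμ J.sibling

theorem hasSum_partialHilbert (S : Set DyadicInterval) :
    HasSum (fun J => S.indicator (fun J => siblingSign J * haarCoeff μ f J) J •
      haarL2 hμ J.sibling) (partialHilbert hμ f S) := by
  refine (summable_smul_haarL2_sibling hμ (.of_nonneg_of_le (fun _ => sq_nonneg _)
    (fun J => ?_) (summable_sq_haarCoeff hμ f))).hasSum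
  by_cases hJ : J ∈ S
  · rw [indicator_of_mem hJ, mul_pow, ← sq_abs (siblingSign J), abs_siblingSign, one_pow, one_mul]
  · rw [indicator_of_notMem hJ, zero_pow two_ne_zero]
    exact sq_nonneg _

theorem partialHilbert_add_compl (S : Set DyadicInterval) :
    partialHilbert hμ f S + partialHilbert hμ f Sᶜ = dyadicHilbert hμ f := by
  refine ((hasSum_partialHilbert hμ f S).add (hasSum_partialHilbert hμ f Sᶜ)).unique ?_
  refine (hasSum_dyadicHilbert_sibling hμ f).congr_fun fun J => ?_
  rw [← add_smul, indicator_self_add_compl_apply]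

theorem norm_sq_partialHilbert (S : Set DyadicInterval) :
    ENNReal.ofReal (‖partialHilbert hμ f S‖ ^ 2) =
      ∑' J, S.indicator (fun J => ENNReal.ofReal (haarCoeff μ f J ^ 2)) J := by
  have h := norm_sq_of_hasSum hμ (hasSum_partialHilbert hμ f S)
  rw [← h.tsum_eq, ENNReal.ofReal_tsum_of_nonneg (fun _ => sq_nonneg _) h.summable]
  refine tsum_congr fun J => ?_
  by_cases hJ : J ∈ S
  · rw [indicator_of_mem hJ, indicator_of_mem hJ, mul_pow, ← sq_abs (siblingSign J),
      abs_siblingSign, one_pow, one_mul]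
  · simp [indicator_of_notMem hJ]

theorem norm_dyadicHilbert_le : ‖dyadicHilbert hμ f‖ ≤ ‖f‖ := by
  have h := norm_sq_of_hasSum hμ (hasSum_dyadicHilbert_sibling hμ f)
  have h2 : ∀ J, (siblingSign J * haarCoeff μ f J) ^ 2 = haarCoeff μ f J ^ 2 := fun J => by
    rw [mul_pow, ← sq_abs (siblingSign J), abs_siblingSign, one_pow, one_mul]
  simp only [h2] at h
  have h3 := tsum_sq_haarCoeff_le hμ f
  rw [h.tsum_eq] at h3
  exact le_of_sq_le_sq h3 (norm_nonneg _)

/-- The only place where balance enters: the term of `J` carries `√m(Jˢ)`, while its coefficient is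
controlled only after multiplication by `√m(J)`. -/
theorem lintegral_compl_stoppingSet_le {K : ℝ} (hf : Integrable f μ) (ht : 0 < t)
    (hK : ∀ J, haarMass μ (sibling J) ≤ K * haarMass μ J) :
    ∫⁻ x in (stoppingSet μ f t)ᶜ, ‖partialHilbert hμ f (goodIntervals μ f t)ᶜ x‖ₑ ∂μ ≤
      ENNReal.ofReal (12 * √K) * ∫⁻ x, ‖f x‖ₑ ∂μ := by
  set M := (stoppingIntervals μ f t).indicator (fun Q => ∫⁻ x in Q.toSet, ‖f x‖ₑ ∂μ) with hM
  have hMle : ∑' J, M J ≤ ∫⁻ x, ‖f x‖ₑ ∂μ :=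
    tsum_indicator_setLIntegral_le _ pairwiseDisjoint_stoppingIntervals
  -- Each stopping interval is counted twice, once as `J` itself and once as a child of its parent.
  have hsum : ∑' J, (M J + (M J.left + M J.right)) ≤ ENNReal.ofReal 2 * ∫⁻ x, ‖f x‖ₑ ∂μ := by
    rw [ENNReal.ofReal_ofNat, ENNReal.tsum_add, ← tsum_childEquiv, two_mul]
    exact add_le_add hMle hMle
  refine (lintegral_enorm_hasSum_le (hasSum_partialHilbert hμ f _) _).trans ?_
  have hterm : ∀ J, ∫⁻ x in (stoppingSet μ f t)ᶜ,
      ‖((goodIntervals μ f t)ᶜ.indicator (fun J => siblingSign J * haarCoeff μ f J) J •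
        haarL2 hμ J.sibling : Lp ℝ 2 μ) x‖ₑ ∂μ ≤
      ENNReal.ofReal (4 * √K) * (M J + (M J.left + M J.right)) := by
    intro J
    set c := (goodIntervals μ f t)ᶜ.indicator (fun J => siblingSign J * haarCoeff μ f J) J with hc
    have e : ∫⁻ x in (stoppingSet μ f t)ᶜ, ‖(c • haarL2 hμ J.sibling : Lp ℝ 2 μ) x‖ₑ ∂μ =
        ‖c‖ₑ * ∫⁻ x in (stoppingSet μ f t)ᶜ, ‖haar μ J.sibling x‖ₑ ∂μ := by
      rw [← lintegral_const_mul _ (measurable_haar _ _).enorm]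
      refine lintegral_congr_ae (ae_restrict_of_ae ?_)
      filter_upwards [Lp.coeFn_smul c (haarL2 hμ J.sibling),
        (memLp_haar hμ J.sibling).coeFn_toLp] with x hx hx'
      rw [hx, Pi.smul_apply, smul_eq_mul, enorm_mul, haarL2, hx']
    rw [e]
    by_cases hJ : J ∈ goodIntervals μ f t
    · rw [hc, indicator_of_notMem (by simpa using hJ)]
      simp
    by_cases hp : ∀ n, J.ancestor (n + 1) ∉ bigIntervals μ f t
    · have hce : ‖c‖ₑ = ENNReal.ofReal |haarCoeff μ f J| := by
        rw [hc, indicator_of_mem (by simpa using hJ), enorm_mul, ← ofReal_norm, ← ofReal_norm,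
          Real.norm_eq_abs, Real.norm_eq_abs, abs_siblingSign, ENNReal.ofReal_one, one_mul]
      have hbad := sqrt_haarMass_mul_abs_haarCoeff_le_of_bad hμ hf hJ hp
      have hsq : √(haarMass μ J.sibling) ≤ √K * √(haarMass μ J) := by
        rw [← Real.sqrt_mul' _ (hμ.haarMass_pos J).le]
        exact Real.sqrt_le_sqrt (hK J)
      calc ‖c‖ₑ * ∫⁻ x in (stoppingSet μ f t)ᶜ, ‖haar μ J.sibling x‖ₑ ∂μ
          ≤ ENNReal.ofReal |haarCoeff μ f J| *
              ENNReal.ofReal (2 * √(haarMass μ J.sibling)) := by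
            rw [hce, ← lintegral_enorm_haar hμ]
            exact mul_le_mul_right (setLIntegral_le_lintegral _ _) _
        _ ≤ ENNReal.ofReal (2 * √K) *
              ENNReal.ofReal (√(haarMass μ J) * |haarCoeff μ f J|) := by
            rw [← ENNReal.ofReal_mul (abs_nonneg _), ← ENNReal.ofReal_mul (by positivity)]
            refine ENNReal.ofReal_le_ofReal ?_
            nlinarith [mul_le_mul_of_nonneg_left hsq (abs_nonneg (haarCoeff μ f J))]
        _ ≤ ENNReal.ofReal (2 * √K) * (2 * (M J + (M J.left + M J.right))) :=
            mul_le_mul_right hbad _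
        _ = ENNReal.ofReal (4 * √K) * (M J + (M J.left + M J.right)) := by
            rw [← mul_assoc, ← ENNReal.ofReal_ofNat 2, ← ENNReal.ofReal_mul (by positivity)]
            congr 2
            ring
    -- A strict ancestor is big, so the parent of `J`, and with it the support of `h_{Jˢ}`, lies in
    -- the stopping set.
    · push Not at hp
      obtain ⟨n, hn⟩ := hp
      have h0 : ∫⁻ x in (stoppingSet μ f t)ᶜ, ‖haar μ J.sibling x‖ₑ ∂μ = 0 := by
        rw [setLIntegral_eq_zero_iff measurableSet_stoppingSet.compl (measurable_haar _ _).enorm]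
        refine ae_of_all _ fun x hx => ?_
        rw [haar_eq_zero, enorm_zero]
        intro hx'
        rw [← parent_ancestor] at hn
        exact hx (toSet_subset_stoppingSet hμ hf ht hn (sibling_subset_parent J hx'))
      rw [h0, mul_zero]
      exact zero_le
  refine (ENNReal.tsum_le_tsum hterm).trans ?_
  rw [ENNReal.tsum_mul_left]
  refine (mul_le_mul_right hsum _).trans ?_
  rw [← mul_assoc, ← ENNReal.ofReal_mul (by positivity)]
  refine mul_le_mul_left (ENNReal.ofReal_le_ofReal ?_) _
  nlinarith [Real.sqrt_nonneg K]

/-- The constant collects `1` from the stopping set, `8` from Chebyshev in `L²` at height `t / 2`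
for the good part, and `24 √K` from Chebyshev in `L¹` for the bad part. -/
theorem weakType_of_haarMass_sibling_le {K : ℝ} (hf : Integrable f μ) (ht : 0 < t)
    (hK : ∀ J, haarMass μ (sibling J) ≤ K * haarMass μ J) :
    ENNReal.ofReal t * μ {x | t < |dyadicHilbert hμ f x|} ≤
      ENNReal.ofReal (9 + 24 * √K) * ∫⁻ x, ‖f x‖ₑ ∂μ := by
  set N := ∫⁻ x, ‖f x‖ₑ ∂μ
  set G := partialHilbert hμ f (goodIntervals μ f t) with hG
  set B := partialHilbert hμ f (goodIntervals μ f t)ᶜ with hB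
  have h1 : ENNReal.ofReal t * μ (stoppingSet μ f t) ≤ N := measure_stoppingSet_le hμ hf ht
  have h2 : ENNReal.ofReal t * μ {x | t / 2 < |G x|} ≤ ENNReal.ofReal 8 * N := by
    have a := (meas_lt_abs_le_of_norm_sq G (half_pos ht)).trans_eq
      (norm_sq_partialHilbert hμ f _)
    have b := a.trans (tsum_sq_haarCoeff_goodIntervals_le hμ hf ht)
    have c := mul_le_mul_right b (ENNReal.ofReal (4 / t))
    rw [← mul_assoc, ← mul_assoc, ← ENNReal.ofReal_mul (by positivity),
      ← ENNReal.ofReal_mul (by positivity)] at c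
    have e1 : 4 / t * (t / 2) ^ 2 = t := by field_simp; norm_num
    have e2 : 4 / t * (2 * t) = 8 := by field_simp; norm_num
    rwa [e1, e2] at c
  have h3 : ENNReal.ofReal t * μ ({x | t / 2 < |B x|} ∩ (stoppingSet μ f t)ᶜ) ≤
      ENNReal.ofReal (24 * √K) * N := by
    have a := (meas_lt_abs_inter_le B (s := t / 2) _ measurableSet_stoppingSet.compl).trans
      (lintegral_compl_stoppingSet_le hμ f hf ht hK)
    have c := mul_le_mul_right a (ENNReal.ofReal 2)
    rw [← mul_assoc, ← mul_assoc, ← ENNReal.ofReal_mul (by positivity),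
      ← ENNReal.ofReal_mul (by positivity)] at c
    have e1 : 2 * (t / 2) = t := by ring
    have e2 : 2 * (12 * √K) = 24 * √K := by ring
    rwa [e1, e2] at c
  have hsub : μ {x | t < |dyadicHilbert hμ f x|} ≤ μ (stoppingSet μ f t ∪
      ({x | t / 2 < |G x|} ∪ ({x | t / 2 < |B x|} ∩ (stoppingSet μ f t)ᶜ))) := by
    refine measure_mono_ae ?_
    have hadd := Lp.coeFn_add G B
    rw [hG, hB, partialHilbert_add_compl] at hadd
    filter_upwards [hadd] with x hx hx'
    have hx' : t < |dyadicHilbert hμ f x| := hx'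
    rw [hx, Pi.add_apply] at hx'
    have habs := abs_add_le (G x) (B x)
    by_cases hs : x ∈ stoppingSet μ f t
    · exact Or.inl hs
    · by_cases hg : t / 2 < |G x|
      · exact Or.inr (Or.inl hg)
      · refine Or.inr (Or.inr ⟨?_, hs⟩)
        change t / 2 < |B x|
        push Not at hg
        have hx'' : t < |G x + B x| := hx'
        linarith
  calc ENNReal.ofReal t * μ {x | t < |dyadicHilbert hμ f x|}
      ≤ ENNReal.ofReal t * (μ (stoppingSet μ f t) + (μ {x | t / 2 < |G x|} +
          μ ({x | t / 2 < |B x|} ∩ (stoppingSet μ f t)ᶜ))) :=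
        mul_le_mul_right (hsub.trans ((measure_union_le _ _).trans
          (add_le_add le_rfl (measure_union_le _ _)))) _
    _ ≤ N + (ENNReal.ofReal 8 * N + ENNReal.ofReal (24 * √K) * N) := by
        rw [mul_add, mul_add]
        exact add_le_add h1 (add_le_add h2 h3)
    _ = ENNReal.ofReal (9 + 24 * √K) * N := by
        rw [show (9 : ℝ) + 24 * √K = 1 + (8 + 24 * √K) by ring,
          ENNReal.ofReal_add one_pos.le (by positivity), ENNReal.ofReal_add (by norm_num)
          (by positivity), ENNReal.ofReal_one]
        ring

end WeakType

/-! ### Real interpolation between weak type `(1,1)` and `L²` -/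

theorem setLIntegral_Ioo_rpow {r a : ℝ} (hr : -1 < r) (ha : 0 ≤ a) :
    ∫⁻ s in Ioo 0 a, ENNReal.ofReal (s ^ r) = ENNReal.ofReal (a ^ (r + 1) / (r + 1)) := by
  rcases ha.eq_or_lt with rfl | ha
  · rw [Real.zero_rpow (by linarith)]; simp
  rw [← ofReal_integral_eq_lintegral_ofReal
    ((intervalIntegral.integrableOn_Ioo_rpow_iff ha).2 hr)
    (ae_restrict_of_forall_mem measurableSet_Ioo fun s hs => Real.rpow_nonneg hs.1.le _),
    ← integral_Ioc_eq_integral_Ioo, ← intervalIntegral.integral_of_le ha.le,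
    integral_rpow (Or.inl hr), Real.zero_rpow (by linarith), sub_zero]

theorem setLIntegral_Ici_rpow {r a : ℝ} (hr : r < -1) (ha : 0 < a) :
    ∫⁻ s in Ici a, ENNReal.ofReal (s ^ r) = ENNReal.ofReal (-a ^ (r + 1) / (r + 1)) := by
  rw [setLIntegral_congr Ioi_ae_eq_Ici.symm, ← ofReal_integral_eq_lintegral_ofReal
    (integrableOn_Ioi_rpow_of_lt hr ha)
    (ae_restrict_of_forall_mem measurableSet_Ioi fun s hs =>
      Real.rpow_nonneg (ha.trans hs).le _),
    integral_Ioi_rpow_of_lt hr ha]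

section Marcinkiewicz

variable {μ : Measure ℝ} {f : ℝ → ℝ} {p : ℝ}

/-- The contribution of the large values of `f` in real interpolation. -/
theorem lintegral_rpow_mul_lintegral_large [SFinite μ] (hf : Measurable f) (hp : 1 < p) :
    ∫⁻ s in Ioi (0 : ℝ), ENNReal.ofReal (s ^ (p - 2)) *
        ∫⁻ x, {x | s < |f x|}.indicator (fun x => ‖f x‖ₑ) x ∂μ =
      ENNReal.ofReal (1 / (p - 1)) * ∫⁻ x, ‖f x‖ₑ ^ p ∂μ := by
  have hm : Measurable (Function.uncurry fun (s x : ℝ) =>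
      ENNReal.ofReal (s ^ (p - 2)) * {x | s < |f x|}.indicator (fun x => ‖f x‖ₑ) x) := by
    refine Measurable.mul (by fun_prop) ?_
    exact (show Measurable fun z : ℝ × ℝ => ‖f z.2‖ₑ by fun_prop).indicator
      (measurableSet_lt measurable_fst (by fun_prop : Measurable fun z : ℝ × ℝ => |f z.2|))
  have hms : ∀ s, Measurable ({x | s < |f x|}.indicator (fun x => ‖f x‖ₑ)) := fun s =>
    hf.enorm.indicator (measurableSet_lt measurable_const (by fun_prop))
  simp_rw [← lintegral_const_mul _ (hms _)]
  rw [lintegral_lintegral_swap hm.aemeasurable,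
    ← lintegral_const_mul _ (hf.enorm.pow_const _)]
  refine lintegral_congr fun x => ?_
  have e : ∀ s ∈ Ioi (0 : ℝ), ENNReal.ofReal (s ^ (p - 2)) *
      {x | s < |f x|}.indicator (fun x => ‖f x‖ₑ) x =
      (Iio |f x|).indicator (fun s => ENNReal.ofReal (s ^ (p - 2)) * ‖f x‖ₑ) s := by
    intro s _
    simp only [indicator, mem_ofPred_eq, mem_Iio]
    split_ifs <;> simp
  rw [setLIntegral_congr_fun measurableSet_Ioi e, lintegral_indicator measurableSet_Iio,
    Measure.restrict_restrict measurableSet_Iio, Iio_inter_Ioi,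
    lintegral_mul_const _ (by fun_prop), setLIntegral_Ioo_rpow (by linarith) (abs_nonneg _)]
  rw [← ofReal_norm, Real.norm_eq_abs, ENNReal.ofReal_rpow_of_nonneg (abs_nonneg _) (by linarith),
    ← ENNReal.ofReal_mul' (abs_nonneg _), ← ENNReal.ofReal_mul' (by positivity)]
  congr 1
  rw [show p - 2 + 1 = p - 1 by ring, div_mul_eq_mul_div, one_div_mul_eq_div]
  congr 1
  rcases (abs_nonneg (f x)).eq_or_lt with h | h
  · rw [← h, mul_zero, Real.zero_rpow (by linarith)]
  · rw [Real.rpow_sub_one h.ne', div_mul_cancel₀ _ h.ne']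

/-- The contribution of the small values of `f` in real interpolation. -/
theorem lintegral_rpow_mul_lintegral_small [SFinite μ] (hf : Measurable f) (hp0 : 0 < p)
    (hp : p < 2) :
    ∫⁻ s in Ioi (0 : ℝ), ENNReal.ofReal (s ^ (p - 3)) *
        ∫⁻ x, {x | s < |f x|}ᶜ.indicator (fun x => ‖f x‖ₑ ^ (2 : ℝ)) x ∂μ =
      ENNReal.ofReal (1 / (2 - p)) * ∫⁻ x, ‖f x‖ₑ ^ p ∂μ := by
  have hm : Measurable (Function.uncurry fun (s x : ℝ) => ENNReal.ofReal (s ^ (p - 3)) *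
      {x | s < |f x|}ᶜ.indicator (fun x => ‖f x‖ₑ ^ (2 : ℝ)) x) := by
    refine Measurable.mul (by fun_prop) ?_
    exact (show Measurable fun z : ℝ × ℝ => ‖f z.2‖ₑ ^ (2 : ℝ) by fun_prop).indicator
      (measurableSet_lt measurable_fst
        (by fun_prop : Measurable fun z : ℝ × ℝ => |f z.2|)).compl
  have hms : ∀ s, Measurable ({x | s < |f x|}ᶜ.indicator (fun x => ‖f x‖ₑ ^ (2 : ℝ))) := fun s =>
    (hf.enorm.pow_const _).indicator (measurableSet_lt measurable_const (by fun_prop)).compl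
  simp_rw [← lintegral_const_mul _ (hms _)]
  rw [lintegral_lintegral_swap hm.aemeasurable,
    ← lintegral_const_mul _ (hf.enorm.pow_const _)]
  refine lintegral_congr fun x => ?_
  -- Zeros of `f` are set apart because `s^(p - 3)` is not integrable near `0`.
  rcases (abs_nonneg (f x)).eq_or_lt with h | h
  · have h0 : f x = 0 := abs_eq_zero.1 h.symm
    simp [indicator, h0, hp0]
  have e : ∀ s ∈ Ioi (0 : ℝ), ENNReal.ofReal (s ^ (p - 3)) *
      {x | s < |f x|}ᶜ.indicator (fun x => ‖f x‖ₑ ^ (2 : ℝ)) x =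
      (Ici |f x|).indicator (fun s => ENNReal.ofReal (s ^ (p - 3)) * ‖f x‖ₑ ^ (2 : ℝ)) s := by
    intro s _
    simp only [indicator, mem_compl_iff, mem_ofPred_eq, mem_Ici, not_lt]
    split_ifs <;> simp
  have hI : Ici |f x| ∩ Ioi 0 = Ici |f x| :=
    inter_eq_left.2 fun s hs => h.trans_le hs
  rw [setLIntegral_congr_fun measurableSet_Ioi e, lintegral_indicator measurableSet_Ici,
    Measure.restrict_restrict measurableSet_Ici, hI,
    lintegral_mul_const _ (by fun_prop), setLIntegral_Ici_rpow (by linarith) h]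
  rw [← ofReal_norm, Real.norm_eq_abs, ENNReal.ofReal_rpow_of_nonneg (abs_nonneg _) hp0.le,
    ENNReal.ofReal_rpow_of_nonneg (abs_nonneg _) zero_le_two,
    ← ENNReal.ofReal_mul' (by positivity), ← ENNReal.ofReal_mul' (by positivity)]
  congr 1
  have h2 : |f x| ^ (2 : ℝ) * |f x| ^ (p - 3 + 1) = |f x| ^ p := by
    rw [← Real.rpow_add h]; congr 1; ring
  rw [← h2, show 2 - p = -(p - 3 + 1) by ring]
  have h3 : p - 3 + 1 ≠ 0 := by linarith
  field_simp

/-- Real interpolation between weak type `(1,1)` and a contraction of `L²`. -/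
theorem lintegral_enorm_rpow_le_of_weakType [SFinite μ] {T : Lp ℝ 2 μ → Lp ℝ 2 μ}
    (hadd : ∀ u v, T (u + v) = T u + T v) (hnorm : ∀ u, ‖T u‖ ≤ ‖u‖) {C : ℝ≥0}
    (hweak : ∀ f : Lp ℝ 2 μ, MemLp f 1 μ → ∀ t : ℝ, 0 < t →
      ENNReal.ofReal t * μ {x | t < |T f x|} ≤ C * eLpNorm f 1 μ)
    (hp1 : 1 < p) (hp2 : p < 2) :
    ∃ A : ℝ≥0, ∀ f : Lp ℝ 2 μ, ∫⁻ x, ‖T f x‖ₑ ^ p ∂μ ≤ A * ∫⁻ x, ‖f x‖ₑ ^ p ∂μ := by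
  have hp0 : 0 < p := by linarith
  refine ⟨Real.toNNReal p * (Real.toNNReal 2 * C * Real.toNNReal (1 / (p - 1)) +
    Real.toNNReal 4 * Real.toNNReal (1 / (2 - p))), fun f => ?_⟩
  have hfm : Measurable f := (Lp.stronglyMeasurable f).measurable
  have hE : ∀ s, MeasurableSet {x | s < |f x|} := fun s =>
    measurableSet_lt measurable_const (by fun_prop)
  -- At each height `s` the function is cut at `|f| = s`: the weak type bound handles the large part
  -- and the `L²` bound the small part, each at level `s / 2`.
  have key : ∀ s ∈ Ioi (0 : ℝ), μ {x | s < |T f x|} * ENNReal.ofReal (s ^ (p - 1)) ≤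
      ENNReal.ofReal 2 * C * (ENNReal.ofReal (s ^ (p - 2)) *
        ∫⁻ x, {x | s < |f x|}.indicator (fun x => ‖f x‖ₑ) x ∂μ) +
      ENNReal.ofReal 4 * (ENNReal.ofReal (s ^ (p - 3)) *
        ∫⁻ x, {x | s < |f x|}ᶜ.indicator (fun x => ‖f x‖ₑ ^ (2 : ℝ)) x ∂μ) := by
    intro s hs
    have hs : 0 < s := hs
    have hg2 := (Lp.memLp f).indicator (hE s)
    have hb2 := (Lp.memLp f).indicator (hE s).compl
    set g := hg2.toLp _ with hg
    set b := hb2.toLp _ with hb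
    have hgb : f = g + b := by
      refine Lp.ext ?_
      filter_upwards [Lp.coeFn_add g b, hg2.coeFn_toLp, hb2.coeFn_toLp] with x h1 h2 h3
      rw [h1, Pi.add_apply, hg, h2, hb, h3, indicator_self_add_compl_apply]
    have hg1 : ∫⁻ x, ‖g x‖ₑ ∂μ = ∫⁻ x, {x | s < |f x|}.indicator (fun x => ‖f x‖ₑ) x ∂μ := by
      refine lintegral_congr_ae ?_
      filter_upwards [hg2.coeFn_toLp] with x h2
      rw [hg, h2, enorm_indicator_eq_indicator_enorm]
    have hb1 : ENNReal.ofReal (‖b‖ ^ 2) =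
        ∫⁻ x, {x | s < |f x|}ᶜ.indicator (fun x => ‖f x‖ₑ ^ (2 : ℝ)) x ∂μ := by
      rw [← lintegral_enorm_sq_Lp_two]
      refine lintegral_congr_ae ?_
      filter_upwards [hb2.coeFn_toLp] with x h2
      rw [hb, h2, enorm_indicator_eq_indicator_enorm]
      by_cases h : x ∈ {x | s < |f x|}ᶜ
      · rw [indicator_of_mem h, indicator_of_mem h]
      · rw [indicator_of_notMem h, indicator_of_notMem h]; simp
    have hgmem : MemLp g 1 μ := by
      refine ⟨Lp.aestronglyMeasurable g, ?_⟩
      rw [eLpNorm_one_eq_lintegral_enorm, hg1]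
      -- The large part is integrable, since `|f| ≤ f² / s` where `|f| > s`.
      have hfin : ∫⁻ x, ‖f x‖ₑ ^ (2 : ℝ) ∂μ < ∞ := by
        rw [lintegral_enorm_sq_Lp_two]; exact ENNReal.ofReal_lt_top
      refine lt_of_le_of_lt ?_ (ENNReal.mul_lt_top (ENNReal.ofReal_lt_top (r := 1 / s)) hfin)
      rw [← lintegral_const_mul _ (hfm.enorm.pow_const _)]
      refine lintegral_mono fun x => ?_
      refine indicator_apply_le' (fun hx => ?_) fun _ => zero_le
      have hx : s < |f x| := hx
      rw [← ofReal_norm, Real.norm_eq_abs, ENNReal.ofReal_rpow_of_nonneg (abs_nonneg _)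
        zero_le_two, ← ENNReal.ofReal_mul (by positivity)]
      refine ENNReal.ofReal_le_ofReal ?_
      rw [Real.rpow_two, one_div_mul_eq_div, le_div_iff₀ hs]
      nlinarith
    have h1 := hweak g hgmem (s / 2) (half_pos hs)
    rw [eLpNorm_one_eq_lintegral_enorm, hg1] at h1
    have h2 := (meas_lt_abs_le_of_norm_sq (T b) (half_pos hs)).trans
      (ENNReal.ofReal_le_ofReal (pow_le_pow_left₀ (norm_nonneg _) (hnorm b) 2))
    rw [hb1] at h2
    have hsub : μ {x | s < |T f x|} ≤
        μ {x | s / 2 < |T g x|} + μ {x | s / 2 < |T b x|} := by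
      refine le_trans (measure_mono_ae ?_) (measure_union_le _ _)
      have hT := Lp.coeFn_add (T g) (T b)
      rw [← hadd, ← hgb] at hT
      filter_upwards [hT] with x hx hx'
      have hx' : s < |T f x| := hx'
      rw [hx, Pi.add_apply] at hx'
      have habs := abs_add_le (T g x) (T b x)
      by_cases hgx : s / 2 < |T g x|
      · exact Or.inl hgx
      · refine Or.inr ?_
        change s / 2 < |T b x|
        push Not at hgx
        linarith
    have e1 : ENNReal.ofReal (s ^ (p - 1)) =
        ENNReal.ofReal (2 * s ^ (p - 2)) * ENNReal.ofReal (s / 2) := by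
      rw [← ENNReal.ofReal_mul (by positivity)]
      congr 1
      rw [show p - 1 = p - 2 + 1 by ring, Real.rpow_add_one hs.ne']
      ring
    have e2 : ENNReal.ofReal (s ^ (p - 1)) =
        ENNReal.ofReal (4 * s ^ (p - 3)) * ENNReal.ofReal ((s / 2) ^ 2) := by
      rw [← ENNReal.ofReal_mul (by positivity)]
      congr 1
      rw [show p - 1 = p - 3 + 1 + 1 by ring, Real.rpow_add_one hs.ne',
        Real.rpow_add_one hs.ne']
      ring
    calc μ {x | s < |T f x|} * ENNReal.ofReal (s ^ (p - 1))
        ≤ (μ {x | s / 2 < |T g x|} + μ {x | s / 2 < |T b x|}) *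
            ENNReal.ofReal (s ^ (p - 1)) := mul_le_mul_left hsub _
      _ = ENNReal.ofReal (2 * s ^ (p - 2)) *
            (ENNReal.ofReal (s / 2) * μ {x | s / 2 < |T g x|}) +
          ENNReal.ofReal (4 * s ^ (p - 3)) *
            (ENNReal.ofReal ((s / 2) ^ 2) * μ {x | s / 2 < |T b x|}) := by
          rw [← mul_assoc, ← mul_assoc, ← e1, ← e2, add_mul, mul_comm, mul_comm (μ _)]
      _ ≤ _ := add_le_add (mul_le_mul_right h1 _) (mul_le_mul_right h2 _)
      _ = _ := by
          rw [ENNReal.ofReal_mul zero_le_two, ENNReal.ofReal_mul zero_le_four]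
          ring
  have hlay := lintegral_rpow_eq_lintegral_meas_lt_mul μ (f := fun x => |T f x|)
    (ae_of_all _ fun _ => abs_nonneg _)
    (Lp.stronglyMeasurable (T f)).measurable.abs.aemeasurable hp0
  have hl : ∫⁻ x, ‖T f x‖ₑ ^ p ∂μ = ∫⁻ x, ENNReal.ofReal (|T f x| ^ p) ∂μ := by
    refine lintegral_congr fun x => ?_
    rw [← ofReal_norm, Real.norm_eq_abs, ENNReal.ofReal_rpow_of_nonneg (abs_nonneg _) hp0.le]
  have hmeas : Measurable fun s : ℝ => ENNReal.ofReal (s ^ (p - 2)) *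
      ∫⁻ x, {x | s < |f x|}.indicator (fun x => ‖f x‖ₑ) x ∂μ := by
    refine Measurable.mul (by fun_prop) (Measurable.lintegral_prod_right'
      (f := fun z : ℝ × ℝ => {x | z.1 < |f x|}.indicator (fun x => ‖f x‖ₑ) z.2) ?_)
    exact (show Measurable fun z : ℝ × ℝ => ‖f z.2‖ₑ by fun_prop).indicator
      (measurableSet_lt measurable_fst (by fun_prop : Measurable fun z : ℝ × ℝ => |f z.2|))
  rw [hl, hlay]
  refine (mul_le_mul_right (setLIntegral_mono_ae' measurableSet_Ioi (ae_of_all _ key)) _).trans ?_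
  rw [lintegral_add_left (hmeas.const_mul _), lintegral_const_mul _ hmeas,
    lintegral_const_mul' _ _ ENNReal.ofReal_ne_top, lintegral_rpow_mul_lintegral_large hfm hp1,
    lintegral_rpow_mul_lintegral_small hfm hp0 hp2]
  push_cast
  simp only [ENNReal.ofReal]
  exact le_of_eq (by ring)

end Marcinkiewicz

/-! ### Duality for exponents above two -/

/-- For an antisymmetric operator, an `L^q` bound with `q ≤ 2` yields the bound with the conjugate
exponent. -/
theorem lintegral_enorm_rpow_le_of_antisymm {μ : Measure ℝ} {T : Lp ℝ 2 μ → Lp ℝ 2 μ}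
    (hanti : ∀ u v, inner ℝ (T u) v = -inner ℝ u (T v)) {p q : ℝ} (hpq : p.HolderConjugate q)
    (hp : 2 < p) {A : ℝ≥0}
    (hA : ∀ f : Lp ℝ 2 μ, ∫⁻ x, ‖T f x‖ₑ ^ q ∂μ ≤ A * ∫⁻ x, ‖f x‖ₑ ^ q ∂μ) (f : Lp ℝ 2 μ) :
    ∫⁻ x, ‖T f x‖ₑ ^ p ∂μ ≤ (A : ℝ≥0∞) ^ (p / q) * ∫⁻ x, ‖f x‖ₑ ^ p ∂μ := by
  set u := T f with hu
  have hum : Measurable u := (Lp.stronglyMeasurable u).measurable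
  have hp0 := hpq.pos
  have hq0 := hpq.symm.pos
  have key : ∀ n : ℕ, ∫⁻ x in {x | |u x| ≤ n}, ‖u x‖ₑ ^ p ∂μ ≤
      (A : ℝ≥0∞) ^ (p / q) * ∫⁻ x, ‖f x‖ₑ ^ p ∂μ := by
    intro n
    set E := {x | |u x| ≤ n} with hEdef
    have hE : MeasurableSet E := measurableSet_le (by fun_prop) measurable_const
    -- The extremal function for duality, cut off where `|u| > n`. The cut puts it in `L²`, so that
    -- antisymmetry applies, and makes `a` finite, so that `a^(1/q)` can be cancelled.
    set g0 : ℝ → ℝ := E.indicator fun x => |u x| ^ (p - 2) * u x with hg0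
    have hg0m : Measurable g0 := Measurable.indicator (by fun_prop) hE
    have hpow : ∀ x, |u x| ^ (p - 2) * |u x| * |u x| = |u x| ^ p := by
      intro x
      rcases (abs_nonneg (u x)).eq_or_lt with h | h
      · rw [← h, mul_zero, Real.zero_rpow hp0.ne']
      · rw [mul_assoc, ← pow_two, ← Real.rpow_two, ← Real.rpow_add h]
        congr 1; ring
    have hg2 : MemLp g0 2 μ := by
      refine MemLp.of_le_mul (c := (n : ℝ) ^ (p - 2)) (Lp.memLp u) hg0m.aestronglyMeasurable
        (ae_of_all _ fun x => ?_)
      rw [hg0, Real.norm_eq_abs, Real.norm_eq_abs]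
      by_cases hx : x ∈ E
      · rw [indicator_of_mem hx, abs_mul, abs_of_nonneg (by positivity)]
        have hx : |u x| ≤ n := hx
        exact mul_le_mul_of_nonneg_right
          (Real.rpow_le_rpow (abs_nonneg _) hx (by linarith)) (abs_nonneg _)
      · rw [indicator_of_notMem hx, abs_zero]; positivity
    set g := hg2.toLp g0 with hg
    set a := ∫⁻ x in E, ‖u x‖ₑ ^ p ∂μ with ha
    have hq : ∫⁻ x, ‖g x‖ₑ ^ q ∂μ = a := by
      rw [ha, ← lintegral_indicator hE]
      refine lintegral_congr_ae ?_
      filter_upwards [hg2.coeFn_toLp] with x hx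
      rw [hg, hx, hg0]
      by_cases hxE : x ∈ E
      · rw [indicator_of_mem hxE, indicator_of_mem hxE, ← ofReal_norm, ← ofReal_norm,
          Real.norm_eq_abs, Real.norm_eq_abs, abs_mul, abs_of_nonneg (by positivity),
          ENNReal.ofReal_rpow_of_nonneg (by positivity) hq0.le,
          ENNReal.ofReal_rpow_of_nonneg (by positivity) hp0.le]
        congr 1
        rcases (abs_nonneg (u x)).eq_or_lt with h | h
        · rw [← h, mul_zero, Real.zero_rpow hq0.ne', Real.zero_rpow hp0.ne']
        · rw [← Real.rpow_add_one h.ne', ← Real.rpow_mul h.le]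
          congr 1
          rw [show p - 2 + 1 = p - 1 by ring]
          exact hpq.sub_one_mul_conj
      · rw [indicator_of_notMem hxE, indicator_of_notMem hxE, enorm_zero,
          ENNReal.zero_rpow_of_pos hq0]
    have hfin : a ≠ ∞ := by
      refine ne_of_lt (lt_of_le_of_lt ?_ (ENNReal.mul_lt_top
        (ENNReal.ofReal_lt_top (r := (n : ℝ) ^ (p - 2))) (?_ : ∫⁻ x, ‖u x‖ₑ ^ (2 : ℝ) ∂μ < ∞)))
      · rw [← lintegral_const_mul _ (hum.enorm.pow_const _), ha, ← lintegral_indicator hE]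
        refine lintegral_mono fun x => indicator_apply_le' (fun hx => ?_) fun _ => zero_le
        have hx : |u x| ≤ n := hx
        rw [← ofReal_norm, Real.norm_eq_abs, ENNReal.ofReal_rpow_of_nonneg (abs_nonneg _) hp0.le,
          ENNReal.ofReal_rpow_of_nonneg (abs_nonneg _) zero_le_two,
          ← ENNReal.ofReal_mul (by positivity), ← hpow, mul_assoc, Real.rpow_two, pow_two]
        exact ENNReal.ofReal_le_ofReal (mul_le_mul_of_nonneg_right
          (Real.rpow_le_rpow (abs_nonneg _) hx (by linarith)) (by positivity))
      · rw [lintegral_enorm_sq_Lp_two]; exact ENNReal.ofReal_lt_top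
    have hinner : a ≤ ‖(inner ℝ u g : ℝ)‖ₑ := by
      have e : (inner ℝ u g : ℝ) = ∫ x, E.indicator (fun x => |u x| ^ p) x ∂μ := by
        rw [L2.inner_def]
        refine integral_congr_ae ?_
        filter_upwards [hg2.coeFn_toLp] with x hx
        rw [hg, hx, hg0]
        by_cases hxE : x ∈ E
        · rw [indicator_of_mem hxE, indicator_of_mem hxE, ← hpow]
          simp only [RCLike.inner_apply, conj_trivial]
          rw [mul_assoc, mul_assoc, abs_mul_abs_self]
        · rw [indicator_of_notMem hxE, indicator_of_notMem hxE, inner_zero_right]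
      have hnn : ∀ x, 0 ≤ E.indicator (fun x => |u x| ^ p) x := fun x =>
        indicator_nonneg (fun x _ => by positivity) x
      have hm' : Measurable (E.indicator fun x => |u x| ^ p) := Measurable.indicator (by fun_prop) hE
      have e2 : ∫⁻ x, ENNReal.ofReal (E.indicator (fun x => |u x| ^ p) x) ∂μ = a := by
        rw [ha, ← lintegral_indicator hE]
        refine lintegral_congr fun x => ?_
        by_cases hxE : x ∈ E
        · rw [indicator_of_mem hxE, indicator_of_mem hxE, ← ofReal_norm, Real.norm_eq_abs,
            ENNReal.ofReal_rpow_of_nonneg (abs_nonneg _) hp0.le]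
        · rw [indicator_of_notMem hxE, indicator_of_notMem hxE, ENNReal.ofReal_zero]
      rw [e, integral_eq_lintegral_of_nonneg_ae (ae_of_all _ hnn) hm'.aestronglyMeasurable, e2,
        Real.enorm_of_nonneg ENNReal.toReal_nonneg, ENNReal.ofReal_toReal hfin]
    have hholder : ‖(inner ℝ u g : ℝ)‖ₑ ≤ (∫⁻ x, ‖f x‖ₑ ^ p ∂μ) ^ (1 / p) *
        (A * a) ^ (1 / q) := by
      rw [hu, hanti, enorm_neg, L2.inner_def]
      refine (enorm_integral_le_lintegral_enorm _).trans ?_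
      have e : ∀ x, ‖(inner ℝ (f x) (T g x) : ℝ)‖ₑ =
          ((fun x => ‖f x‖ₑ) * fun x => ‖T g x‖ₑ) x := fun x => by
        simp only [RCLike.inner_apply, conj_trivial, enorm_mul, Pi.mul_apply]
        exact mul_comm _ _
      simp_rw [e]
      refine (ENNReal.lintegral_mul_le_Lp_mul_Lq μ hpq
        (Lp.aestronglyMeasurable f).aemeasurable.enorm
        (Lp.aestronglyMeasurable (T g)).aemeasurable.enorm).trans ?_
      refine mul_le_mul_right (ENNReal.rpow_le_rpow ?_ (by positivity)) _
      exact (hA g).trans_eq (by rw [hq])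
    rcases eq_or_ne a 0 with h0 | h0
    · rw [h0]; exact zero_le
    have hmain := hinner.trans hholder
    rw [ENNReal.mul_rpow_of_nonneg _ _ (by positivity), ← mul_assoc] at hmain
    have hsplit : a = a ^ (1 / p) * a ^ (1 / q) := by
      rw [← ENNReal.rpow_add _ _ h0 hfin, one_div, one_div, hpq.inv_add_inv_eq_one,
        ENNReal.rpow_one]
    have haq0 : a ^ (1 / q) ≠ 0 := (ENNReal.rpow_pos (pos_iff_ne_zero.2 h0) hfin).ne'
    have haqt : a ^ (1 / q) ≠ ∞ := ENNReal.rpow_ne_top_of_nonneg (by positivity) hfin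
    conv_lhs at hmain => rw [hsplit]
    rw [ENNReal.mul_le_mul_iff_left haq0 haqt] at hmain
    have h3 := ENNReal.rpow_le_rpow hmain hp0.le
    rw [ENNReal.mul_rpow_of_nonneg _ _ hp0.le, ← ENNReal.rpow_mul, ← ENNReal.rpow_mul,
      ← ENNReal.rpow_mul, one_div_mul_cancel hp0.ne', ENNReal.rpow_one, ENNReal.rpow_one,
      one_div_mul_eq_div] at h3
    rwa [mul_comm]
  have hU : ⋃ n : ℕ, {x | |u x| ≤ n} = univ := by
    refine eq_univ_of_forall fun x => mem_iUnion.2 ?_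
    exact exists_nat_ge |u x|
  have hdir : Directed (· ⊆ ·) fun n : ℕ => {x | |u x| ≤ n} := by
    refine Monotone.directed_le fun m n hmn x hx => ?_
    exact le_trans (show |u x| ≤ m from hx) (by exact_mod_cast hmn)
  rw [← setLIntegral_univ, ← hU, setLIntegral_iUnion_of_directed _ hdir]
  exact iSup_le key

/-! ### Algebra of the operator and sufficiency of balance -/

section Hilbert

variable {μ : Measure ℝ} (hμ : IsDyadicMeasure μ)

theorem haarCoeff_eq_inner (f : Lp ℝ 2 μ) (J : DyadicInterval) :
    haarCoeff μ f J = inner ℝ (haarL2 hμ J) f := (inner_haarL2 hμ J f).symm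

theorem dyadicHilbert_add (u v : Lp ℝ 2 μ) :
    dyadicHilbert hμ (u + v) = dyadicHilbert hμ u + dyadicHilbert hμ v := by
  refine (hasSum_dyadicHilbert_sibling hμ (u + v)).unique ?_
  refine ((hasSum_dyadicHilbert_sibling hμ u).add
    (hasSum_dyadicHilbert_sibling hμ v)).congr_fun fun J => ?_
  simp only [haarCoeff_eq_inner hμ, inner_add_right, mul_add, add_smul]

theorem inner_dyadicHilbert (u v : Lp ℝ 2 μ) :
    inner ℝ (dyadicHilbert hμ u) v = -inner ℝ u (dyadicHilbert hμ v) := by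
  have h1 := (hasSum_dyadicHilbert hμ u).mapL (innerSL ℝ v)
  have h2 := ((hasSum_dyadicHilbert hμ v).mapL (innerSL ℝ u)).neg
  rw [real_inner_comm]
  refine h1.unique (h2.congr_fun fun I => ?_)
  simp only [dyadicHilbertTerm, ← inner_haarL2 hμ, innerSL_apply_apply, inner_sub_right,
    inner_smul_right, real_inner_comm (haarL2 hμ _)]
  ring

theorem dyadicHilbert_haarL2 (J : DyadicInterval) :
    dyadicHilbert hμ (haarL2 hμ J) = siblingSign J • haarL2 hμ J.sibling := by
  classical
  refine (hasSum_dyadicHilbert_sibling hμ (haarL2 hμ J)).unique ?_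
  have hort := orthonormal_iff_ite.1 (orthonormal_haarL2 hμ)
  convert hasSum_single J fun I hI => ?_ using 1
  · rw [haarCoeff_eq_inner hμ, hort, if_pos rfl, mul_one]
  · rw [haarCoeff_eq_inner hμ, hort, if_neg hI, mul_zero, zero_smul]

theorem abs_dyadicHilbert_haarL2 (J : DyadicInterval) :
    ∀ᵐ x ∂μ, |dyadicHilbert hμ (haarL2 hμ J) x| = |haar μ J.sibling x| := by
  rw [dyadicHilbert_haarL2]
  filter_upwards [Lp.coeFn_smul (siblingSign J) (haarL2 hμ J.sibling),
    (memLp_haar hμ J.sibling).coeFn_toLp] with x hx hx'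
  rw [hx, Pi.smul_apply, smul_eq_mul, abs_mul, abs_siblingSign, one_mul, haarL2, hx']

include hμ in
theorem IsDyadicMeasure.sigmaFinite : SigmaFinite μ := by
  refine Measure.sigmaFinite_of_countable (S := range DyadicInterval.toSet) (countable_range _)
    (by rintro _ ⟨J, rfl⟩; exact hμ.lt_top J) ?_
  refine eq_univ_of_forall fun x => mem_sUnion.2 ⟨_, ⟨⟨0, ⌊x / 2 ^ (0 : ℤ)⌋⟩, rfl⟩, ?_⟩
  rw [mem_toSet_iff]

include hμ in
theorem siblingBalanced_iff :
    SiblingBalanced μ ↔ ∃ K, ∀ J : DyadicInterval, haarMass μ J.sibling ≤ K * haarMass μ J := by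
  constructor
  · rintro ⟨K, hK⟩
    refine ⟨K, fun J => ?_⟩
    have := hK ⟨J.sibling, rfl⟩
    simp only [sibling_sibling] at this
    rwa [div_le_iff₀ (hμ.haarMass_pos J)] at this
  · rintro ⟨K, hK⟩
    refine ⟨K, ?_⟩
    rintro _ ⟨J, rfl⟩
    have := hK J.sibling
    rw [sibling_sibling] at this
    exact (div_le_iff₀ (hμ.haarMass_pos _)).2 this

theorem hilbertWeakType11_of_siblingBalanced (h : SiblingBalanced μ) : HilbertWeakType11 hμ := by
  obtain ⟨K, hK⟩ := (siblingBalanced_iff hμ).1 h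
  refine ⟨Real.toNNReal (9 + 24 * √K), fun f hf t ht => ?_⟩
  rw [eLpNorm_one_eq_lintegral_enorm]
  exact weakType_of_haarMass_sibling_le hμ f (memLp_one_iff_integrable.1 hf) ht hK

theorem hilbertBoundedOnLp_of_lintegral {p : ℝ≥0∞} (hp0 : p ≠ 0) (hpt : p ≠ ∞) {A : ℝ≥0}
    (hA : ∀ f : Lp ℝ 2 μ, ∫⁻ x, ‖dyadicHilbert hμ f x‖ₑ ^ p.toReal ∂μ ≤
      A * ∫⁻ x, ‖f x‖ₑ ^ p.toReal ∂μ) : HilbertBoundedOnLp hμ p := by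
  refine ⟨A ^ (1 / p.toReal), fun f _ => ?_⟩
  have hp : 0 < p.toReal := ENNReal.toReal_pos hp0 hpt
  rw [eLpNorm_eq_lintegral_rpow_enorm_toReal hp0 hpt, eLpNorm_eq_lintegral_rpow_enorm_toReal hp0 hpt,
    ENNReal.coe_rpow_of_nonneg _ (by positivity), ← ENNReal.mul_rpow_of_nonneg _ _ (by positivity)]
  exact ENNReal.rpow_le_rpow (hA f) (by positivity)

theorem hilbertBoundedOnLp_of_siblingBalanced (h : SiblingBalanced μ) {p : ℝ≥0∞} (hp1 : 1 < p)
    (hpt : p < ∞) : HilbertBoundedOnLp hμ p := by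
  have := hμ.sigmaFinite
  obtain ⟨C, hC⟩ := hilbertWeakType11_of_siblingBalanced hμ h
  have hsmall : ∀ q : ℝ, 1 < q → q < 2 → ∃ A : ℝ≥0, ∀ f : Lp ℝ 2 μ,
      ∫⁻ x, ‖dyadicHilbert hμ f x‖ₑ ^ q ∂μ ≤ A * ∫⁻ x, ‖f x‖ₑ ^ q ∂μ := fun q h1 h2 =>
    lintegral_enorm_rpow_le_of_weakType (dyadicHilbert_add hμ) (norm_dyadicHilbert_le hμ) hC h1 h2
  have hp0 : p ≠ 0 := (zero_lt_one.trans hp1).ne'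
  have hp1' : 1 < p.toReal := by
    rw [← ENNReal.toReal_one]
    exact (ENNReal.toReal_lt_toReal ENNReal.one_ne_top hpt.ne).2 hp1
  suffices ∃ A : ℝ≥0, ∀ f : Lp ℝ 2 μ, ∫⁻ x, ‖dyadicHilbert hμ f x‖ₑ ^ p.toReal ∂μ ≤
      A * ∫⁻ x, ‖f x‖ₑ ^ p.toReal ∂μ by
    obtain ⟨A, hA⟩ := this
    exact hilbertBoundedOnLp_of_lintegral hμ hp0 hpt.ne hA
  rcases lt_trichotomy p.toReal 2 with h2 | h2 | h2
  · exact hsmall _ hp1' h2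
  · refine ⟨1, fun f => ?_⟩
    rw [h2, lintegral_enorm_sq_Lp_two, lintegral_enorm_sq_Lp_two, ENNReal.coe_one, one_mul]
    exact ENNReal.ofReal_le_ofReal
      (pow_le_pow_left₀ (norm_nonneg _) (norm_dyadicHilbert_le hμ f) 2)
  · have hpq := Real.HolderConjugate.conjExponent hp1'
    obtain ⟨A, hA⟩ := hsmall _ hpq.symm.lt (by
      rw [Real.conjExponent, div_lt_iff₀ (by linarith)]; linarith)
    refine ⟨A ^ (p.toReal / p.toReal.conjExponent), fun f => ?_⟩
    rw [ENNReal.coe_rpow_of_nonneg _ (div_nonneg hpq.nonneg hpq.symm.nonneg)]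
    exact lintegral_enorm_rpow_le_of_antisymm (inner_dyadicHilbert hμ) hpq h2 hA f

/-! ### Necessity of balance: testing on Haar functions -/

include hμ in
-- As `1 - p < 0`, the smaller child dominates the norm, and its measure is at most `2 m(J)`.
theorem le_lintegral_enorm_haar_rpow {p : ℝ} (hp : 1 < p) (J : DyadicInterval) :
    ENNReal.ofReal (2 ^ (1 - p) * haarMass μ J ^ (1 - p / 2)) ≤
      ∫⁻ x, ‖haar μ J x‖ₑ ^ p ∂μ := by
  rw [lintegral_enorm_haar_rpow hμ J (by linarith)]
  refine ENNReal.ofReal_le_ofReal ?_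
  have hm := hμ.haarMass_pos J
  have hl := hμ.real_pos J.left
  have hr := hμ.real_pos J.right
  have e : 2 ^ (1 - p) * haarMass μ J ^ (1 - p / 2) =
      haarMass μ J ^ (p / 2) * (2 * haarMass μ J) ^ (1 - p) := by
    rw [Real.mul_rpow zero_le_two hm.le, mul_left_comm, ← Real.rpow_add hm]
    congr 2; ring
  rw [e]
  refine mul_le_mul_of_nonneg_left ?_ (by positivity)
  have h1 := Real.rpow_nonneg hl.le (1 - p)
  have h2 := Real.rpow_nonneg hr.le (1 - p)
  rcases hμ.left_le_or_right_le J with h | h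
  · have := Real.rpow_le_rpow_of_nonpos hl h (by linarith : 1 - p ≤ 0)
    linarith
  · have := Real.rpow_le_rpow_of_nonpos hr h (by linarith : 1 - p ≤ 0)
    linarith

include hμ in
theorem lintegral_enorm_haar_rpow_le {p : ℝ} (hp : 1 < p) (J : DyadicInterval) :
    ∫⁻ x, ‖haar μ J x‖ₑ ^ p ∂μ ≤ ENNReal.ofReal (2 * haarMass μ J ^ (1 - p / 2)) := by
  rw [lintegral_enorm_haar_rpow hμ J (by linarith)]
  refine ENNReal.ofReal_le_ofReal ?_
  have hm := hμ.haarMass_pos J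
  have e : 2 * haarMass μ J ^ (1 - p / 2) =
      haarMass μ J ^ (p / 2) * (haarMass μ J ^ (1 - p) + haarMass μ J ^ (1 - p)) := by
    rw [← two_mul, mul_left_comm, ← Real.rpow_add hm]
    congr 2; ring
  rw [e]
  refine mul_le_mul_of_nonneg_left (add_le_add ?_ ?_) (by positivity)
  · exact Real.rpow_le_rpow_of_nonpos hm (hμ.haarMass_le_left J) (by linarith)
  · exact Real.rpow_le_rpow_of_nonpos hm (hμ.haarMass_le_right J) (by linarith)

theorem siblingBalanced_of_hilbertBoundedOnLp {p : ℝ≥0∞} (hp1 : 1 < p) (hpt : p < ∞)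
    (hp2 : p ≠ 2) (h : HilbertBoundedOnLp hμ p) : SiblingBalanced μ := by
  obtain ⟨C, hC⟩ := h
  have hp0 : p ≠ 0 := (zero_lt_one.trans hp1).ne'
  have hr1 : 1 < p.toReal := by
    rw [← ENNReal.toReal_one]
    exact (ENNReal.toReal_lt_toReal ENNReal.one_ne_top hpt.ne).2 hp1
  have hr2 : p.toReal ≠ 2 := fun h => hp2 (by
    rw [← ENNReal.ofReal_toReal hpt.ne, h]; simp)
  set r := p.toReal with hr
  have hr0 : 0 < r := by linarith
  -- The operator bound tested on `h_J`; the factor `2 ^ r` is the ratio of the constants `2` and `2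
  -- ^ (1 - r)` in the two norm estimates.
  have key : ∀ J : DyadicInterval, haarMass μ J.sibling ^ (1 - r / 2) ≤
      (2 ^ r * (C : ℝ) ^ r) * haarMass μ J ^ (1 - r / 2) := by
    intro J
    have hm := hμ.haarMass_pos J
    have hms := hμ.haarMass_pos J.sibling
    have e1 : ∫⁻ x, ‖haarL2 hμ J x‖ₑ ^ r ∂μ = ∫⁻ x, ‖haar μ J x‖ₑ ^ r ∂μ := by
      refine lintegral_congr_ae ?_
      filter_upwards [(memLp_haar hμ J).coeFn_toLp] with x hx
      rw [haarL2, hx]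
    have e2 : ∫⁻ x, ‖dyadicHilbert hμ (haarL2 hμ J) x‖ₑ ^ r ∂μ =
        ∫⁻ x, ‖haar μ J.sibling x‖ₑ ^ r ∂μ := by
      refine lintegral_congr_ae ?_
      filter_upwards [abs_dyadicHilbert_haarL2 hμ J] with x hx
      rw [← ofReal_norm, ← ofReal_norm, Real.norm_eq_abs, Real.norm_eq_abs, hx]
    have hmem : MemLp (haarL2 hμ J) p μ := by
      refine ⟨Lp.aestronglyMeasurable _, ?_⟩
      rw [eLpNorm_lt_top_iff_lintegral_rpow_enorm_lt_top hp0 hpt.ne, ← hr, e1]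
      exact (lintegral_enorm_haar_rpow_le hμ hr1 J).trans_lt ENNReal.ofReal_lt_top
    have h1 := hC _ hmem
    rw [eLpNorm_eq_lintegral_rpow_enorm_toReal hp0 hpt.ne,
      eLpNorm_eq_lintegral_rpow_enorm_toReal hp0 hpt.ne, ← hr, e1, e2] at h1
    have h2 := ENNReal.rpow_le_rpow h1 hr0.le
    rw [ENNReal.mul_rpow_of_nonneg _ _ hr0.le, ← ENNReal.rpow_mul, ← ENNReal.rpow_mul,
      one_div_mul_cancel hr0.ne', ENNReal.rpow_one, ENNReal.rpow_one] at h2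
    have h3 := (le_lintegral_enorm_haar_rpow hμ hr1 J.sibling).trans
      (h2.trans (mul_le_mul_right (lintegral_enorm_haar_rpow_le hμ hr1 J) _))
    rw [← ENNReal.ofReal_coe_nnreal, ENNReal.ofReal_rpow_of_nonneg C.coe_nonneg hr0.le,
      ← ENNReal.ofReal_mul (by positivity), ENNReal.ofReal_le_ofReal_iff (by positivity),
      Real.rpow_sub two_pos, Real.rpow_one, div_mul_eq_mul_div, div_le_iff₀ (by positivity)] at h3
    nlinarith
  set D := 2 ^ r * (C : ℝ) ^ r with hD
  have hD0 : 0 ≤ D := by positivity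
  refine (siblingBalanced_iff hμ).2 ?_
  rcases lt_or_gt_of_ne hr2 with hlt | hgt
  · have he : 0 < 1 - r / 2 := by linarith
    refine ⟨D ^ (1 / (1 - r / 2)), fun J => ?_⟩
    have hm := hμ.haarMass_pos J
    have hms := hμ.haarMass_pos J.sibling
    refine (Real.rpow_le_rpow_iff hms.le (by positivity) he).1 ?_
    rw [Real.mul_rpow (by positivity) hm.le, ← Real.rpow_mul hD0, one_div_mul_cancel he.ne',
      Real.rpow_one]
    exact key J
  · have he : 0 < r / 2 - 1 := by linarith
    refine ⟨D ^ (1 / (r / 2 - 1)), fun J => ?_⟩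
    have hm := hμ.haarMass_pos J
    have hms := hμ.haarMass_pos J.sibling
    refine (Real.rpow_le_rpow_iff hms.le (by positivity) he).1 ?_
    rw [Real.mul_rpow (by positivity) hm.le, ← Real.rpow_mul hD0, one_div_mul_cancel he.ne',
      Real.rpow_one]
    -- For `r > 2` the exponent is negative and reverses the inequality, so the roles of `J` and its
    -- sibling are exchanged.
    have h1 := key J.sibling
    rw [sibling_sibling, show 1 - r / 2 = -(r / 2 - 1) by ring, Real.rpow_neg hm.le,
      Real.rpow_neg hms.le, ← div_eq_mul_inv, le_div_iff₀ (by positivity), inv_mul_eq_div,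
      div_le_iff₀ (by positivity)] at h1
    exact h1

/-- On a child `Q` of `Jˢ`, `|h_{Jˢ}|` equals `√m(Jˢ) / μ(Q)`. At half this height the weak type
bound for `h_J` compares `√m(Jˢ)` with `‖h_J‖₁ = 2 √m(J)`; the measure of `Q` cancels, so either
child would do. -/
theorem siblingBalanced_of_hilbertWeakType11 (h : HilbertWeakType11 hμ) : SiblingBalanced μ := by
  obtain ⟨C, hC⟩ := h
  refine (siblingBalanced_iff hμ).2 ⟨(8 * C) ^ 2, fun J => ?_⟩
  have hm := hμ.haarMass_pos J
  have hms := hμ.haarMass_pos J.sibling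
  have e1 : eLpNorm (haarL2 hμ J) 1 μ = ENNReal.ofReal (2 * √(haarMass μ J)) := by
    rw [eLpNorm_one_eq_lintegral_enorm, ← lintegral_enorm_haar hμ]
    refine lintegral_congr_ae ?_
    filter_upwards [(memLp_haar hμ J).coeFn_toLp] with x hx
    rw [haarL2, hx]
  have hmem : MemLp (haarL2 hμ J) 1 μ :=
    ⟨Lp.aestronglyMeasurable _, by rw [e1]; exact ENNReal.ofReal_lt_top⟩
  have key : ∀ Q : DyadicInterval,
      (∀ x ∈ Q.toSet, |haar μ J.sibling x| = √(haarMass μ J.sibling) / μ.real Q.toSet) →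
      √(haarMass μ J.sibling) ≤ 8 * C * √(haarMass μ J) := by
    intro Q hQ
    have hq := hμ.real_pos Q
    have hs : 0 < √(haarMass μ J.sibling) := Real.sqrt_pos.2 hms
    set t := √(haarMass μ J.sibling) / μ.real Q.toSet / 2 with ht
    have ht0 : 0 < t := by positivity
    have h1 := hC _ hmem t ht0
    have h2 : μ Q.toSet ≤ μ {x | t < |dyadicHilbert hμ (haarL2 hμ J) x|} := by
      refine measure_mono_ae ?_
      filter_upwards [abs_dyadicHilbert_haarL2 hμ J] with x hx hxQ
      change t < |dyadicHilbert hμ (haarL2 hμ J) x|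
      rw [hx, hQ x hxQ]
      exact half_lt_self (by positivity)
    have h3 := (mul_le_mul_right h2 (ENNReal.ofReal t)).trans h1
    rw [e1, ← hμ.ofReal_real, ← ENNReal.ofReal_mul ht0.le, ← ENNReal.ofReal_coe_nnreal,
      ← ENNReal.ofReal_mul C.coe_nonneg, ENNReal.ofReal_le_ofReal_iff (by positivity)] at h3
    have h4 : t * μ.real Q.toSet = √(haarMass μ J.sibling) / 2 := by
      rw [ht]; field_simp
    rw [h4] at h3
    have := mul_nonneg C.coe_nonneg (Real.sqrt_nonneg (haarMass μ J))
    linarith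
  have h5 := key J.sibling.left fun x hx => by
    rw [haar_of_mem_left hx, abs_of_nonneg (by positivity)]
  have h6 := pow_le_pow_left₀ (Real.sqrt_nonneg _) h5 2
  rwa [mul_pow, Real.sq_sqrt hms.le, Real.sq_sqrt hm.le] at h6

end Hilbert

end

theorem mainTheorem4 (μ : Measure ℝ) (hμ : IsDyadicMeasure μ) :
    List.TFAE [
      ∀ p : ℝ≥0∞, 1 < p → p < ∞ → HilbertBoundedOnLp hμ p,
      ∃ p : ℝ≥0∞, 1 < p ∧ p < ∞ ∧ p ≠ 2 ∧ HilbertBoundedOnLp hμ p,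
      SiblingBalanced μ,
      HilbertWeakType11 hμ] := by
  tfae_have 1 → 2 := fun h => ⟨3, by norm_num, by norm_num, by norm_num,
    h 3 (by norm_num) (by norm_num)⟩
  tfae_have 2 → 3 := fun ⟨p, h1, ht, h2, h⟩ =>
    siblingBalanced_of_hilbertBoundedOnLp hμ h1 ht h2 h
  tfae_have 3 → 1 := fun h p h1 ht => hilbertBoundedOnLp_of_siblingBalanced hμ h h1 ht
  tfae_have 3 → 4 := hilbertWeakType11_of_siblingBalanced hμ
  tfae_have 4 → 3 := siblingBalanced_of_hilbertWeakType11 hμ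
  tfae_finish
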